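/- Let $n\in\mathbb{N}$, $a<b$, $\tau>0$, let $A,A_d\in L_\infty^{n\times 3n}[a,b]$ and $B\in\mathbb{R}^{2n\times 4n}$. Write $L_2=L_2^n$, let $H_2^n[a,b]$ be the space of $u\in L_2[a,b]$ with weak derivatives $\partial_x u,\partial_x^2u\in L_2[a,b]$, and $H_{(1,2)}^n$ the space of $\phi\in L_2([0,1]\times[a,b])$ (variables $(s,x)$) with weak derivatives $\partial_s^{i}\partial_x^{j}\phi\in L_2$ for $i\le 1$, $j\le 2$, both with their Sobolev norms. Put $$X_B=\Big\{u\in H_2^n[a,b] : B\begin{bmatrix}u(a)\\u_x(a)\\u(b)\\u_x(b)\end{bmatrix}=0\Big\},\qquad Y_u=\{\phi\in H_{(1,2)}^n : \phi(0,\cdot)=u,\ \phi(s,\cdot)\in X_B\ \forall s\in[0,1]\},$$ where point values are those of the continuous representatives ($u,u_x$ continuous on $[a,b]$; $s\mapsto\phi(s,\cdot)$ continuous from $[0,1]$ to $H_2^n[a,b]$). Let $$H=\begin{bmatrix}I_n&0\\0&I_n\\I_n&(b-a)I_n\\0&I_n\end{bmatrix},\quad Q(\theta)=\begin{bmatrix}0\\0\\(b-\theta)I_n\\I_n\end{bmatrix},\quad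 K(x)=\begin{bmatrix}I_n&(x-a)I_n\end{bmatrix},$$ and assume that $BH\in\mathbb{R}^{2n\times 2n}$ is invertible. Set $T_2(x,\theta)=-K(x)(BH)^{-1}BQ(\theta)$, $T_1(x,\theta)=(x-\theta)I_n+T_2(x,\theta)$ and, for $C\in\{A,A_d\}$, $$(\mathcal{T}_1v)(x)=\int_a^xT_1(x,\theta)v(\theta)\,d\theta+\int_x^bT_2(x,\theta)v(\theta)\,d\theta,$$ $$(\mathcal{P}_Cv)(x)=C(x)\begin{bmatrix}0\\0\\I_n\end{bmatrix}v(x)+\int_a^xC(x)\begin{bmatrix}T_1(x,\theta)\\\partial_xT_1(x,\theta)\\0\end{bmatrix}v(\theta)\,d\theta+\int_x^bC(x)\begin{bmatrix}T_2(x,\theta)\\\partial_xT_2(x,\theta)\\0\end{bmatrix}v(\theta)\,d\theta .$$ On $Z=L_2[a,b]\times L_2([0,1]\times[a,b])$ define $$\mathcal{T}\begin{bmatrix}v\\\psi\end{bmatrix}=\begin{bmatrix}\mathcal{T}_1v\\ \mathcal{T}_1v+\int_0^s\mathcal{T}_1\psi(\theta)\,d\theta\end{bmatrix},\qquad \mathcal{A}\begin{bmatrix}v\\\psi\end{bmatrix}=\begin{bmatrix}\mathcal{P}_Av+\mathcal{P}_{A_d}v+\int_0^1\mathcal{P}_{A_d}\psi(s)\,ds\\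 -\tfrac1\tau\mathcal{T}_1\psi(s)\end{bmatrix}.$$ A solution of the PIE with initial state $(v_0,\psi_0)\in Z$ is a differentiable function $(v,\psi):[0,\infty)\to Z$ with $(v,\psi)(0)=(v_0,\psi_0)$ and $\mathcal{T}(v_t(t),\psi_t(t))=\mathcal{A}(v(t),\psi(t))$ for all $t\ge0$. A solution of the delayed PDE (DPDE) with initial state $(u_0,\phi_0)$, $u_0\in X_B$, $\phi_0\in Y_{u_0}$, is a differentiable function $(u,\phi):[0,\infty)\to H_2^n[a,b]\times H_{(1,2)}^n$ with $(u,\phi)(0)=(u_0,\phi_0)$ such that for all $t\ge0$: $u(t)\in X_B$, $\phi(t)\in Y_{u(t)}$ and $$u_t(t)=A\begin{bmatrix}u(t)\\u_x(t)\\u_{xx}(t)\end{bmatrix}+A_d\begin{bmatrix}\phi(t,1)\\\phi_x(t,1)\\\phi_{xx}(t,1)\end{bmatrix},\qquad \phi_t(t)=-\tfrac1\tau\phi_s(t).$$ Then: 1. For all $(v_0,\psi_0)\in Z$ and all $(v,\psi):[0,\infty)\to Z$: $(v,\psi)$ is a solution of the PIE with initial state $(v_0,\psi_0)$ if and only if $(u,\phi)=\mathcal{T}(v,\psi)$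 is a solution of the DPDE with initial state $(u_0,\phi_0)=\mathcal{T}(v_0,\psi_0)$. 2. Conversely, for all $u_0\in X_B$, $\phi_0\in Y_{u_0}$ and all $(u,\phi)$ with $u(t)\in X_B$, $\phi(t)\in Y_{u(t)}$ for $t\ge0$: $(u,\phi)$ is a solution of the DPDE with initial state $(u_0,\phi_0)$ if and only if $(\partial_x^2u,\partial_s\partial_x^2\phi)$ is a solution of the PIE with initial state $(\partial_x^2u_0,\partial_s\partial_x^2\phi_0)$. -/

import Mathlib

open MeasureTheory Set Filter Topology Matrix

noncomputable section

namespace DPDE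

/-! ### Function spaces -/

/-- `ℝⁿ` with its Euclidean norm. -/
abbrev E (n : ℕ) : Type := EuclideanSpace ℝ (Fin n)

/-- `L₂ⁿ[Ω]`. -/
abbrev L2 {V : Type} [MeasureSpace V] (n : ℕ) (Ω : Set V) : Type :=
  Lp (E n) 2 ((volume : Measure V).restrict Ω)

/-- The rectangle `[0,1] × [a,b]`, with points `(s, x)`. -/
def box (a b : ℝ) : Set (ℝ × ℝ) := Icc 0 1 ×ˢ Icc a b

set_option linter.unusedSectionVars false

section WeakDerivative

variable {V : Type} [NormedAddCommGroup V] [NormedSpace ℝ V] [MeasureSpace V]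

/-- `g` is the weak derivative of `f` in the direction `e` on the interior of `Ω`. -/
def IsWeakDeriv {n : ℕ} {Ω : Set V} (e : V) (f g : L2 n Ω) : Prop :=
  ∀ χ : TestFunction (TopologicalSpace.Opens.interior Ω) ℝ ⊤,
    ∫ p in Ω, χ p • g p = - ∫ p in Ω, (fderiv ℝ χ p e) • f p

variable [BorelSpace V] [IsLocallyFiniteMeasure (volume : Measure V)]

lemma integrable_test_smul {n : ℕ} {Ω : Set V} (f : L2 n Ω) {χ : V → ℝ}
    (hc : Continuous χ) (hs : HasCompactSupport χ) :
    Integrable (fun p => χ p • f p) (volume.restrict Ω) :=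
  ((Lp.memLp f).locallyIntegrable (by norm_num)).integrable_smul_left_of_hasCompactSupport hc hs

lemma continuous_fderiv_test {Ω : TopologicalSpace.Opens V} (χ : TestFunction Ω ℝ ⊤) (e : V) :
    Continuous (fun p => fderiv ℝ χ p e) :=
  (χ.contDiff.continuous_fderiv (by simp)).clm_apply continuous_const

lemma hasCompactSupport_fderiv_test {Ω : TopologicalSpace.Opens V} (χ : TestFunction Ω ℝ ⊤)
    (e : V) : HasCompactSupport (fun p => fderiv ℝ χ p e) :=
  χ.hasCompactSupport.fderiv_apply ℝ e

lemma IsWeakDeriv.zero {n : ℕ} {Ω : Set V} (e : V) : IsWeakDeriv e (0 : L2 n Ω) 0 := by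
  intro χ
  have h := Lp.coeFn_zero (E n) 2 ((volume : Measure V).restrict Ω)
  rw [integral_eq_zero_of_ae, integral_eq_zero_of_ae, neg_zero]
  · filter_upwards [h] with p hp; simp only [hp, Pi.zero_apply, smul_zero]
  · filter_upwards [h] with p hp; simp only [hp, Pi.zero_apply, smul_zero]

lemma IsWeakDeriv.add {n : ℕ} {Ω : Set V} {e : V} {f g f' g' : L2 n Ω}
    (h : IsWeakDeriv e f g) (h' : IsWeakDeriv e f' g') :
    IsWeakDeriv e (f + f') (g + g') := by
  intro χ
  have key : ∀ (c : V → ℝ) (_ : Continuous c) (_ : HasCompactSupport c) (k k' : L2 n Ω),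
      ∫ p in Ω, c p • (k + k' : L2 n Ω) p = (∫ p in Ω, c p • k p) + ∫ p in Ω, c p • k' p := by
    intro c hc hs k k'
    rw [← integral_add (integrable_test_smul k hc hs) (integrable_test_smul k' hc hs)]
    refine integral_congr_ae ?_
    filter_upwards [Lp.coeFn_add k k'] with p hp
    simp only [hp, Pi.add_apply, smul_add]
  rw [key _ χ.contDiff.continuous χ.hasCompactSupport,
    key _ (continuous_fderiv_test χ e) (hasCompactSupport_fderiv_test χ e), h χ, h' χ, neg_add]

lemma IsWeakDeriv.smul {n : ℕ} {Ω : Set V} {e : V} {f g : L2 n Ω} (r : ℝ)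
    (h : IsWeakDeriv e f g) : IsWeakDeriv e (r • f) (r • g) := by
  intro χ
  have key : ∀ (c : V → ℝ) (k : L2 n Ω),
      ∫ p in Ω, c p • (r • k : L2 n Ω) p = r • ∫ p in Ω, c p • k p := by
    intro c k
    rw [← integral_smul]
    refine integral_congr_ae ?_
    filter_upwards [Lp.coeFn_smul r k] with p hp
    simp only [hp, Pi.smul_apply]
    exact smul_comm _ _ _
  rw [key, key, h χ, smul_neg]

end WeakDerivative

/-- `H_kⁿ[a,b]`: an element is the family `(u, ∂ₓu, …, ∂ₓᵏu)` of an `L₂` function together with its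
weak derivatives, and the norm is the (maximum form of the) Sobolev norm. -/
def Sob1 (n k : ℕ) (a b : ℝ) : Submodule ℝ (Fin (k + 1) → L2 n (Icc a b)) where
  carrier := {u | ∀ i : Fin k, IsWeakDeriv 1 (u i.castSucc) (u i.succ)}
  zero_mem' := fun _ => IsWeakDeriv.zero _
  add_mem' := fun h h' i => (h i).add (h' i)
  smul_mem' := fun r _ h i => (h i).smul r

/-- `H_{(k,l)}ⁿ[[0,1]×[a,b]]`: an element is the family `φ i j = ∂ₛⁱ∂ₓʲφ`, `i ≤ k`, `j ≤ l`, of an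
`L₂` function together with its weak derivatives, and the norm is the (maximum form of the) Sobolev
norm. -/
def Sob2 (n k l : ℕ) (a b : ℝ) :
    Submodule ℝ (Fin (k + 1) → Fin (l + 1) → L2 n (box a b)) where
  carrier := {φ | (∀ (i : Fin k) (j : Fin (l + 1)),
        IsWeakDeriv ((1 : ℝ), (0 : ℝ)) (φ i.castSucc j) (φ i.succ j)) ∧
      ∀ (i : Fin (k + 1)) (j : Fin l),
        IsWeakDeriv ((0 : ℝ), (1 : ℝ)) (φ i j.castSucc) (φ i j.succ)}
  zero_mem' := ⟨fun _ _ => IsWeakDeriv.zero _, fun _ _ => IsWeakDeriv.zero _⟩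
  add_mem' := fun h h' =>
    ⟨fun i j => (h.1 i j).add (h'.1 i j), fun i j => (h.2 i j).add (h'.2 i j)⟩
  smul_mem' := fun r _ h => ⟨fun i j => (h.1 i j).smul r, fun i j => (h.2 i j).smul r⟩

/-- `H₂ⁿ[a,b]`; for `u : H2 n a b`, `u.1 j` is `∂ₓʲu`. -/
abbrev H2 (n : ℕ) (a b : ℝ) : Type := Sob1 n 2 a b

/-- `H_{(1,2)}ⁿ[[0,1]×[a,b]]`; for `φ : H12 n a b`, `φ.1 i j` is `∂ₛⁱ∂ₓʲφ`. -/
abbrev H12 (n : ℕ) (a b : ℝ) : Type := Sob2 n 1 2 a b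

/-! ### Matrices -/

/-- `L_∞` for matrix-valued functions on `[a,b]`. -/
def MemLinfty {m k : Type} (a b : ℝ) (A : ℝ → Matrix m k ℝ) : Prop :=
  ∀ i j, MemLp (fun x => A x i j) ⊤ (volume.restrict (Icc a b))

/-- The product `M v`, as a vector of `ℝⁿ`. -/
def mulE {n : ℕ} {k : Type} [Fintype k] (M : Matrix (Fin n) k ℝ) (v : k → ℝ) : E n :=
  WithLp.toLp 2 (M *ᵥ v)

/-- The stacked vector `col(w₀, w₁, …)`. -/
def stack {m n : ℕ} (w : Fin m → E n) : Fin m × Fin n → ℝ := fun i => w i.1 i.2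

/-- The block column `col(M₀, M₁, …)`. -/
def blockCol {m n : ℕ} (M : Fin m → Matrix (Fin n) (Fin n) ℝ) :
    Matrix (Fin m × Fin n) (Fin n) ℝ := Matrix.of fun i j => M i.1 i.2 j

/-- The block row `[M₀ M₁ …]`. -/
def blockRow {m n : ℕ} (M : Fin m → Matrix (Fin n) (Fin n) ℝ) :
    Matrix (Fin n) (Fin m × Fin n) ℝ := Matrix.of fun i j => M j.1 i j.2

/-- `H`, for which `H col(c, d)` lists the boundary values `u(a), uₓ(a), u(b), uₓ(b)` of the affine
function `u(x) = c + (x - a) d`. -/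
def Hmat (n : ℕ) (a b : ℝ) : Matrix (Fin 4 × Fin n) (Fin 2 × Fin n) ℝ :=
  Matrix.comp (Fin 4) (Fin 2) (Fin n) (Fin n) ℝ
    !![1, 0; 0, 1; 1, (b - a) • (1 : Matrix (Fin n) (Fin n) ℝ); 0, 1]

/-- `Q(θ)`, listing the boundary values `u(a), uₓ(a), u(b), uₓ(b)` of
`u(x) = max (x - θ) 0`. -/
def Qmat (n : ℕ) (b θ : ℝ) : Matrix (Fin 4 × Fin n) (Fin n) ℝ :=
  blockCol ![0, 0, (b - θ) • 1, 1]

/-- `K(x) = [I (x-a)I]`. -/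
def Kmat (n : ℕ) (a x : ℝ) : Matrix (Fin n) (Fin 2 × Fin n) ℝ :=
  blockRow ![1, (x - a) • 1]

section Operators

variable {n : ℕ} (a b : ℝ) (B : Matrix (Fin 2 × Fin n) (Fin 4 × Fin n) ℝ)

/-- The kernel `T₂(x,θ) = -K(x)(BH)⁻¹BQ(θ)`. -/
def kerT2 (x θ : ℝ) : Matrix (Fin n) (Fin n) ℝ :=
  -(Kmat n a x * (B * Hmat n a b)⁻¹ * B * Qmat n b θ)

/-- The kernel `T₁(x,θ) = (x-θ)I + T₂(x,θ)`. -/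
def kerT1 (x θ : ℝ) : Matrix (Fin n) (Fin n) ℝ :=
  (x - θ) • 1 + kerT2 a b B x θ

/-- The entrywise derivative `∂ₓR(x,θ)` of a matrix kernel. -/
def dxKer (R : ℝ → ℝ → Matrix (Fin n) (Fin n) ℝ) (x θ : ℝ) : Matrix (Fin n) (Fin n) ℝ :=
  Matrix.of fun i j => deriv (fun y => R y θ i j) x

/-- The 3-PI operator with parameters `{R₀, R₁, R₂}`. -/
def threePI (R₀ : ℝ → Matrix (Fin n) (Fin n) ℝ) (R₁ R₂ : ℝ → ℝ → Matrix (Fin n) (Fin n) ℝ)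
    (u : ℝ → E n) (x : ℝ) : E n :=
  mulE (R₀ x) (u x).ofLp + (∫ θ in a..x, mulE (R₁ x θ) (u θ).ofLp) + ∫ θ in x..b, mulE (R₂ x θ) (u θ).ofLp

/-- `𝒯₁`. -/
def opT1 (v : ℝ → E n) : ℝ → E n :=
  threePI a b 0 (kerT1 a b B) (kerT2 a b B) v

/-- `𝒯₂`. -/
def opT2 (ψ : ℝ × ℝ → E n) (p : ℝ × ℝ) : E n :=
  ∫ θ in (0 : ℝ)..p.1, opT1 a b B (fun y => ψ (θ, y)) p.2

/-- `𝒜₁₁` for the coefficient `A`; with `A_d` in place of `A` this is `𝒜₁₁,d`. -/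
def opA11 (A : ℝ → Matrix (Fin n) (Fin 3 × Fin n) ℝ) (v : ℝ → E n) : ℝ → E n :=
  threePI a b (fun x => A x * blockCol ![0, 0, 1])
    (fun x θ => A x * blockCol ![kerT1 a b B x θ, dxKer (kerT1 a b B) x θ, 0])
    (fun x θ => A x * blockCol ![kerT2 a b B x θ, dxKer (kerT2 a b B) x θ, 0]) v

/-- `𝒜₁₂`. -/
def opA12 (Ad : ℝ → Matrix (Fin n) (Fin 3 × Fin n) ℝ) (ψ : ℝ × ℝ → E n) (x : ℝ) : E n :=
  ∫ s in (0 : ℝ)..1, opA11 a b B Ad (fun y => ψ (s, y)) x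

/-- `𝒜₂₂`. -/
def opA22 (τ : ℝ) (ψ : ℝ × ℝ → E n) (p : ℝ × ℝ) : E n :=
  -(1 / τ) • opT1 a b B (fun y => ψ (p.1, y)) p.2

/-- Pairs of a function of `x` and a function of `(s, x)`. -/
abbrev FunPair (n : ℕ) : Type := (ℝ → E n) × (ℝ × ℝ → E n)

/-- The block operator `𝒯`. -/
def opT (f : FunPair n) : FunPair n :=
  (opT1 a b B f.1, fun p => opT1 a b B f.1 p.2 + opT2 a b B f.2 p)

/-- The block operator `𝒜`. -/
def opA (τ : ℝ) (A Ad : ℝ → Matrix (Fin n) (Fin 3 × Fin n) ℝ) (f : FunPair n) : FunPair n :=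
  (fun x => opA11 a b B A f.1 x + opA11 a b B Ad f.1 x + opA12 a b B Ad f.2 x,
    opA22 a b B τ f.2)

end Operators

/-- Equality almost everywhere on `[a,b]` and on `[0,1]×[a,b]`. -/
def EqAE {n : ℕ} (a b : ℝ) (f g : FunPair n) : Prop :=
  f.1 =ᵐ[volume.restrict (Icc a b)] g.1 ∧ f.2 =ᵐ[volume.restrict (box a b)] g.2

/-! ### Partial integral equations -/

/-- The state space `L₂ⁿ[a,b] × L₂ⁿ[[0,1]×[a,b]]`. -/
abbrev Z (n : ℕ) (a b : ℝ) : Type := L2 n (Icc a b) × L2 n (box a b)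

/-- The pair of functions underlying an element of the state space. -/
def Z.toFun {n : ℕ} {a b : ℝ} (z : Z n a b) : FunPair n := (z.1, z.2)

/-- `z` is a solution on `[0,∞)` of the PIE `𝒯 z_t = 𝒜 z` with initial state `z₀`. -/
def IsPIESolution {n : ℕ} {a b : ℝ} (T A : FunPair n → FunPair n)
    (z₀ : Z n a b) (z : ℝ → Z n a b) : Prop :=
  DifferentiableOn ℝ z (Ici 0) ∧ z 0 = z₀ ∧
    ∀ t, 0 ≤ t → EqAE a b (T (derivWithin z (Ici 0) t).toFun) (A (z t).toFun)

/-! ### The delayed PDE -/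

/-- `X_B`. The boundary values of `u` and `uₓ` are those of their continuous representatives. -/
def XB {n : ℕ} (a b : ℝ) (B : Matrix (Fin 2 × Fin n) (Fin 4 × Fin n) ℝ) : Set (H2 n a b) :=
  {u | ∃ f f' : ℝ → E n, ContinuousOn f (Icc a b) ∧ ContinuousOn f' (Icc a b) ∧
    u.1 0 =ᵐ[volume.restrict (Icc a b)] f ∧ u.1 1 =ᵐ[volume.restrict (Icc a b)] f' ∧
    B *ᵥ stack ![f a, f' a, f b, f' b] = 0}

/-- `φ(s,·) = w`: the value at `s` of the representative of `φ` that is continuous from `[0,1]`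
to `H₂`. -/
def HasTrace {n : ℕ} {a b : ℝ} (φ : H12 n a b) (s : ℝ) (w : H2 n a b) : Prop :=
  ∃ S : ℝ → H2 n a b, ContinuousOn S (Icc 0 1) ∧
    (∀ᵐ r ∂(volume.restrict (Icc (0 : ℝ) 1)), ∀ j : Fin 3,
      (S r).1 j =ᵐ[volume.restrict (Icc a b)] fun x => φ.1 0 j (r, x)) ∧
    S s = w

/-- `Y_u`. -/
def YB {n : ℕ} (a b : ℝ) (B : Matrix (Fin 2 × Fin n) (Fin 4 × Fin n) ℝ) (u : H2 n a b) :
    Set (H12 n a b) :=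
  {φ | HasTrace φ 0 u ∧ ∀ s ∈ Icc (0 : ℝ) 1, ∃ w ∈ XB a b B, HasTrace φ s w}

/-- The pairs `(u, φ)` with `u ∈ X_B` and `φ ∈ Y_u`. -/
def dom {n : ℕ} (a b : ℝ) (B : Matrix (Fin 2 × Fin n) (Fin 4 × Fin n) ℝ) :
    Set (H2 n a b × H12 n a b) :=
  {w | w.1 ∈ XB a b B ∧ w.2 ∈ YB a b B w.1}

/-- The pair of functions `(u, φ)` underlying an element of `H₂ × H_{(1,2)}`. -/
def sobFun {n : ℕ} {a b : ℝ} (w : H2 n a b × H12 n a b) : FunPair n := (w.1.1 0, w.2.1 0 0)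

/-- `(u, φ) ↦ (∂ₓ²u, ∂ₛ∂ₓ²φ)`. -/
def fund {n : ℕ} {a b : ℝ} (w : H2 n a b × H12 n a b) : Z n a b := (w.1.1 2, w.2.1 1 2)

/-- `w = (u, φ)` is a solution on `[0,∞)` of the delayed PDE given by `{A, A_d, B, τ}`, in the form
`u_t = A col(u,uₓ,uₓₓ) + A_d col(φ,φₓ,φₓₓ)(·,1)`, `u ∈ X_B`, `φ_t = -(1/τ) φ_s`, `φ ∈ Y_u`,
with initial state `w₀ = (u₀, φ₀)`. Differentiability in time is with respect to the norm of
`H₂ × H_{(1,2)}`. -/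
def IsDPDESolution {n : ℕ} {a b : ℝ} (τ : ℝ) (A Ad : ℝ → Matrix (Fin n) (Fin 3 × Fin n) ℝ)
    (B : Matrix (Fin 2 × Fin n) (Fin 4 × Fin n) ℝ)
    (w₀ : H2 n a b × H12 n a b) (w : ℝ → H2 n a b × H12 n a b) : Prop :=
  w₀ ∈ dom a b B ∧ DifferentiableOn ℝ w (Ici 0) ∧ w 0 = w₀ ∧
    ∀ t, 0 ≤ t → w t ∈ dom a b B ∧
      (∃ d : H2 n a b, HasTrace (w t).2 1 d ∧
        (derivWithin w (Ici 0) t).1.1 0 =ᵐ[volume.restrict (Icc a b)] fun x =>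
          mulE (A x) (stack fun j : Fin 3 => (w t).1.1 j x) +
            mulE (Ad x) (stack fun j : Fin 3 => d.1 j x)) ∧
      (derivWithin w (Ici 0) t).2.1 0 0 = -(1 / τ) • (w t).2.1 1 0

end DPDE

end

noncomputable section

namespace DPDE

set_option linter.unusedSectionVars false

/-! ### Integral operators with bounded kernels -/

section KernelOperator

open scoped ENNReal

variable {α β X : Type*} [MeasurableSpace α] [MeasurableSpace β] [MeasurableSpace X]
  {F : Type*} [NormedAddCommGroup F] [NormedSpace ℝ F]

lemma eLpNorm_two_rpow (m : Measure α) (f : α → F) :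
    eLpNorm f 2 m ^ (2 : ℝ) = ∫⁻ x, ‖f x‖ₑ ^ (2 : ℝ) ∂m :=
  eLpNorm_nnreal_pow_eq_lintegral (p := 2) (by norm_num)

/-- Integrating out the second variable is bounded from `L₂(ρ × μ)` to `L₂(ρ)`. -/
lemma eLpNorm_integral_prod_right_le {ρ : Measure β} {μ : Measure X} [SFinite ρ] [SFinite μ]
    {h : β × X → F} (hh : AEStronglyMeasurable h (ρ.prod μ)) :
    eLpNorm (fun p => ∫ x, h (p, x) ∂μ) 2 ρ
      ≤ (μ univ) ^ (1 / 2 : ℝ) * eLpNorm h 2 (ρ.prod μ) := by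
  rw [← ENNReal.rpow_le_rpow_iff (z := (2 : ℝ)) (by norm_num),
    ENNReal.mul_rpow_of_nonneg _ _ (by norm_num), eLpNorm_two_rpow, eLpNorm_two_rpow, ← ENNReal.rpow_mul]
  norm_num only [one_div, ENNReal.rpow_one]
  rw [lintegral_prod _ (hh.enorm.pow_const _)]
  rw [← lintegral_const_mul'' _ (hh.enorm.pow_const _).lintegral_prod_right']
  refine lintegral_mono_ae ?_
  filter_upwards [hh.prodMk_left] with p hp
  have h1 : ‖∫ x, h (p, x) ∂μ‖ₑ ≤ eLpNorm (fun x => h (p, x)) 1 μ := by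
    rw [eLpNorm_one_eq_lintegral_enorm]
    exact enorm_integral_le_lintegral_enorm _
  have h2 := h1.trans (eLpNorm_le_eLpNorm_mul_rpow_measure_univ (q := 2) (by norm_num) hp)
  calc ‖∫ x, h (p, x) ∂μ‖ₑ ^ (2 : ℝ) ≤ _ := ENNReal.rpow_le_rpow h2 (by norm_num)
    _ = _ := by
      rw [ENNReal.mul_rpow_of_nonneg _ _ (by norm_num), eLpNorm_two_rpow, ← ENNReal.rpow_mul, mul_comm]
      norm_num

/-- The operator `f ↦ ∫ K(p,x) f(g(p,x)) dμ(x)`. -/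
def kerOp (μ : Measure X) (K : β × X → F →L[ℝ] F) (g : β × X → α) (f : α → F) (p : β) : F :=
  ∫ x, K (p, x) (f (g (p, x))) ∂μ

variable {ν : Measure α} {ρ : Measure β} {μ : Measure X} [IsFiniteMeasure ρ] [IsFiniteMeasure μ]
  {K : β × X → F →L[ℝ] F} {g : β × X → α} {c : ℝ≥0∞} {C : ℝ}

lemma kerOp_congr_ae (hg : Measurable g) (hm : (ρ.prod μ).map g ≤ c • ν)
    {f f' : α → F} (h : f =ᵐ[ν] f') : kerOp μ K g f =ᵐ[ρ] kerOp μ K g f' := by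
  have h1 : f ∘ g =ᵐ[ρ.prod μ] f' ∘ g := by
    refine ae_eq_comp hg.aemeasurable ?_
    exact ((Measure.absolutelyContinuous_of_le hm).trans
      (Measure.smul_absolutelyContinuous)).ae_eq h
  filter_upwards [Measure.ae_ae_of_ae_prod h1] with p hp
  refine integral_congr_ae ?_
  filter_upwards [hp] with x hx
  simp only [Function.comp_apply] at hx
  rw [hx]

lemma memLp_kernel_smul (hK : AEStronglyMeasurable K (ρ.prod μ))
    (hC : ∀ᵐ q ∂(ρ.prod μ), ‖K q‖ ≤ C) (hg : Measurable g) (hc : c ≠ ⊤)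
    (hm : (ρ.prod μ).map g ≤ c • ν) {f : α → F} (hf : MemLp f 2 ν) :
    MemLp (fun q => K q (f (g q))) 2 (ρ.prod μ) ∧
      eLpNorm (fun q => K q (f (g q))) 2 (ρ.prod μ)
        ≤ ENNReal.ofReal C * (c ^ (1 / 2 : ℝ) * eLpNorm f 2 ν) := by
  have h1 : MemLp f 2 ((ρ.prod μ).map g) := hf.of_measure_le_smul hc hm
  have h2 : MemLp (f ∘ g) 2 (ρ.prod μ) := h1.comp_of_map hg.aemeasurable
  have h3 : ∀ᵐ q ∂(ρ.prod μ), ‖K q (f (g q))‖ ≤ C * ‖(f ∘ g) q‖ := by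
    filter_upwards [hC] with q hq
    exact (K q).le_of_opNorm_le hq _
  refine ⟨h2.of_le_mul ?_ h3, (eLpNorm_le_mul_eLpNorm_of_ae_le_mul h3 2).trans ?_⟩
  · exact (ContinuousLinearMap.id ℝ (F →L[ℝ] F)).aestronglyMeasurable_comp₂ hK h2.1
  · gcongr
    rw [← eLpNorm_map_measure h1.1 hg.aemeasurable]
    refine (eLpNorm_mono_measure _ hm).trans (le_of_eq ?_)
    rw [eLpNorm_smul_measure_of_ne_top (by norm_num)]
    norm_num

/-- The operator `kerOp` is bounded from `L₂(ν)` to `L₂(ρ)`. -/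
lemma exists_kerOp_clm (hK : AEStronglyMeasurable K (ρ.prod μ))
    (hC : ∀ᵐ q ∂(ρ.prod μ), ‖K q‖ ≤ C) (hg : Measurable g) (hc : c ≠ ⊤)
    (hm : (ρ.prod μ).map g ≤ c • ν) :
    ∃ T : Lp F 2 ν →L[ℝ] Lp F 2 ρ, (∀ f, T f =ᵐ[ρ] kerOp μ K g f) ∧
      ∀ f, ‖T f‖ ≤ ((μ univ) ^ (1 / 2 : ℝ) * (ENNReal.ofReal C * c ^ (1 / 2 : ℝ))).toReal * ‖f‖ := by
  have hP : ∀ f : Lp F 2 ν, _ := fun f => memLp_kernel_smul hK hC hg hc hm (Lp.memLp f)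
  have hN : ∀ f : Lp F 2 ν, eLpNorm (kerOp μ K g f) 2 ρ ≤
      ((μ univ) ^ (1 / 2 : ℝ) * (ENNReal.ofReal C * c ^ (1 / 2 : ℝ))) * eLpNorm f 2 ν := by
    intro f
    refine (eLpNorm_integral_prod_right_le (hP f).1.1).trans ?_
    rw [mul_assoc, mul_assoc]
    gcongr
    exact (hP f).2
  have hfin : (μ univ) ^ (1 / 2 : ℝ) * (ENNReal.ofReal C * c ^ (1 / 2 : ℝ)) ≠ ⊤ :=
    ENNReal.mul_ne_top (ENNReal.rpow_ne_top_of_nonneg (by norm_num) (measure_ne_top _ _))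
      (ENNReal.mul_ne_top ENNReal.ofReal_ne_top (ENNReal.rpow_ne_top_of_nonneg (by norm_num) hc))
  have hmem : ∀ f : Lp F 2 ν, MemLp (kerOp μ K g f) 2 ρ := fun f =>
    ⟨(hP f).1.1.integral_prod_right', (hN f).trans_lt
      (ENNReal.mul_lt_top hfin.lt_top (Lp.memLp f).2)⟩
  have hint : ∀ f : Lp F 2 ν, ∀ᵐ p ∂ρ, Integrable (fun x => K (p, x) (f (g (p, x)))) μ :=
    fun f => ((hP f).1.integrable (by norm_num)).prod_right_ae
  let T₀ : Lp F 2 ν →ₗ[ℝ] Lp F 2 ρ :=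
    { toFun := fun f => (hmem f).toLp
      map_add' := by
        intro f f'
        rw [← MemLp.toLp_add, MemLp.toLp_eq_toLp_iff]
        refine (kerOp_congr_ae hg hm (Lp.coeFn_add f f')).trans ?_
        filter_upwards [hint f, hint f'] with p h h'
        simp only [kerOp, Pi.add_apply, map_add]
        exact integral_add h h'
      map_smul' := by
        intro r f
        rw [RingHom.id_apply, ← MemLp.toLp_const_smul, MemLp.toLp_eq_toLp_iff]
        refine (kerOp_congr_ae hg hm (Lp.coeFn_smul r f)).trans ?_
        refine Eventually.of_forall fun p => ?_
        simp only [kerOp, Pi.smul_apply, map_smul]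
        exact integral_smul _ _ }
  have hT₀ : ∀ f, ‖T₀ f‖ ≤
      ((μ univ) ^ (1 / 2 : ℝ) * (ENNReal.ofReal C * c ^ (1 / 2 : ℝ))).toReal * ‖f‖ := by
    intro f
    change ‖(hmem f).toLp‖ ≤ _
    rw [Lp.norm_toLp, Lp.norm_def, ← ENNReal.toReal_mul]
    exact ENNReal.toReal_mono (ENNReal.mul_ne_top hfin (Lp.memLp f).2.ne) (hN f)
  exact ⟨T₀.mkContinuous _ hT₀, fun f => (hmem f).coeFn_toLp, hT₀⟩

end KernelOperator

/-! ### Weak derivatives and primitives -/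

section Primitive

variable {F : Type*} [NormedAddCommGroup F] [NormedSpace ℝ F]

lemma intervalIntegral_left_eq_setIntegral_ite {a b x : ℝ} (hx : x ∈ Icc a b) (h : ℝ → F) :
    ∫ θ in a..x, h θ = ∫ θ in Icc a b, if θ ≤ x then h θ else 0 := by
  rw [intervalIntegral.integral_of_le hx.1, ← integral_Icc_eq_integral_Ioc]
  have : (fun θ => if θ ≤ x then h θ else 0) = (Iic x).indicator h := by
    ext θ; simp [indicator]
  rw [this, setIntegral_indicator measurableSet_Iic]
  congr 2
  ext θ
  simp only [mem_Icc, mem_inter_iff, mem_Iic]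
  constructor
  · rintro ⟨h1, h2⟩; exact ⟨⟨h1, h2.trans hx.2⟩, h2⟩
  · rintro ⟨⟨h1, _⟩, h2⟩; exact ⟨h1, h2⟩

/-- Integration by parts against the primitive of an integrable function. -/
lemma integral_deriv_smul_integral {a b : ℝ} {h : ℝ → F} [CompleteSpace F]
    (hh : IntegrableOn h (Icc a b)) {χ : ℝ → ℝ} (hχ : ContDiff ℝ 1 χ) (hb : χ b = 0) :
    ∫ x in Icc a b, deriv χ x • ∫ θ in a..x, h θ = -∫ x in Icc a b, χ x • h x := by
  have hd : Continuous (deriv χ) := hχ.continuous_deriv (by norm_num)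
  have hdint : ∀ u v, ∫ x in u..v, deriv χ x = χ v - χ u := fun u v =>
    intervalIntegral.integral_deriv_eq_sub (fun x _ => (hχ.differentiable (by norm_num)) x)
      (hd.intervalIntegrable _ _)
  have hprod : Integrable (Function.uncurry fun x θ : ℝ => if θ ≤ x then deriv χ x • h θ else 0)
      ((volume.restrict (Icc a b)).prod (volume.restrict (Icc a b))) := by
    have h1 : Integrable (fun q : ℝ × ℝ => deriv χ q.1 • h q.2)
        ((volume.restrict (Icc a b)).prod (volume.restrict (Icc a b))) :=
      (hd.integrableOn_Icc (μ := volume)).smul_prod hh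
    have h2 : MeasurableSet {q : ℝ × ℝ | q.2 ≤ q.1} :=
      measurableSet_le measurable_snd measurable_fst
    refine (h1.indicator h2).congr (Eventually.of_forall fun q => ?_)
    simp [indicator, Function.uncurry]
  calc ∫ x in Icc a b, deriv χ x • ∫ θ in a..x, h θ
      = ∫ x in Icc a b, ∫ θ in Icc a b, if θ ≤ x then deriv χ x • h θ else 0 := by
        refine setIntegral_congr_fun measurableSet_Icc fun x hx => ?_
        rw [intervalIntegral_left_eq_setIntegral_ite hx, ← integral_smul]
        simp only [smul_ite, smul_zero]
    _ = ∫ θ in Icc a b, ∫ x in Icc a b, if θ ≤ x then deriv χ x • h θ else 0 :=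
        integral_integral_swap hprod
    _ = ∫ θ in Icc a b, -(χ θ • h θ) := by
        refine setIntegral_congr_fun measurableSet_Icc fun θ hθ => ?_
        have : (fun x => if θ ≤ x then deriv χ x • h θ else 0)
            = (Ici θ).indicator fun x => deriv χ x • h θ := by
          ext x; simp [indicator]
        simp only [this]
        rw [setIntegral_indicator measurableSet_Ici, integral_smul_const]
        have hs : Icc a b ∩ Ici θ = Icc θ b := by
          ext x
          simp only [mem_Icc, mem_inter_iff, mem_Ici]
          constructor
          · rintro ⟨⟨_, h2⟩, h1⟩; exact ⟨h1, h2⟩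
          · rintro ⟨h1, h2⟩; exact ⟨⟨hθ.1.trans h1, h2⟩, h1⟩
        rw [hs, integral_Icc_eq_integral_Ioc, ← intervalIntegral.integral_of_le hθ.2, hdint, hb,
          zero_sub, neg_smul]
    _ = _ := integral_neg _

lemma integral_deriv_smul_primitive {a b : ℝ} (hab : a ≤ b) {h : ℝ → F} [CompleteSpace F]
    (hh : IntegrableOn h (Icc a b)) (c : F) {χ : ℝ → ℝ} (hχ : ContDiff ℝ 1 χ)
    (ha : χ a = 0) (hb : χ b = 0) :
    ∫ x in Icc a b, deriv χ x • (c + ∫ θ in a..x, h θ) = -∫ x in Icc a b, χ x • h x := by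
  have hd : Continuous (deriv χ) := hχ.continuous_deriv (by norm_num)
  have hdint : ∀ u v, ∫ x in u..v, deriv χ x = χ v - χ u := fun u v =>
    intervalIntegral.integral_deriv_eq_sub (fun x _ => (hχ.differentiable (by norm_num)) x)
      (hd.intervalIntegrable _ _)
  have hI : ContinuousOn (fun x => ∫ θ in a..x, h θ) (Icc a b) := by
    have := intervalIntegral.continuousOn_primitive_interval (μ := volume) (a := a) (b := b) (f := h)
      (by rwa [uIcc_of_le hab])
    rwa [uIcc_of_le hab] at this
  have i1 : IntegrableOn (fun x => deriv χ x • c) (Icc a b) :=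
    (hd.smul continuous_const).integrableOn_Icc
  have i2 : IntegrableOn (fun x => deriv χ x • ∫ θ in a..x, h θ) (Icc a b) :=
    (hd.continuousOn.smul hI).integrableOn_Icc
  simp only [smul_add]
  rw [integral_add i1 i2, integral_smul_const, integral_Icc_eq_integral_Ioc,
    ← intervalIntegral.integral_of_le hab, hdint, ha, hb, sub_zero, zero_smul, zero_add]
  exact integral_deriv_smul_integral hh hχ hb

end Primitive

lemma volume_restrict_box (a b : ℝ) : (volume : Measure (ℝ × ℝ)).restrict (box a b)
    = (volume.restrict (Icc (0 : ℝ) 1)).prod (volume.restrict (Icc a b)) := by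
  rw [Measure.prod_restrict, box, Measure.volume_eq_prod]

instance isFiniteMeasure_restrict_box (a b : ℝ) :
    IsFiniteMeasure ((volume : Measure (ℝ × ℝ)).restrict (box a b)) := by
  rw [volume_restrict_box]; infer_instance

lemma integral_box {F : Type*} [NormedAddCommGroup F] [NormedSpace ℝ F] {a b : ℝ} {h : ℝ × ℝ → F}
    (hh : IntegrableOn h (box a b)) :
    ∫ p in box a b, h p = ∫ s in Icc 0 1, ∫ x in Icc a b, h (s, x) := by
  rw [IntegrableOn, volume_restrict_box] at hh
  rw [volume_restrict_box, integral_prod _ hh]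

lemma integral_box_symm {F : Type*} [NormedAddCommGroup F] [NormedSpace ℝ F] {a b : ℝ}
    {h : ℝ × ℝ → F} (hh : IntegrableOn h (box a b)) :
    ∫ p in box a b, h p = ∫ x in Icc a b, ∫ s in Icc 0 1, h (s, x) := by
  rw [IntegrableOn, volume_restrict_box] at hh
  rw [volume_restrict_box, integral_prod_symm _ hh]

lemma interior_box (a b : ℝ) : interior (box a b) = Ioo 0 1 ×ˢ Ioo a b := by
  rw [box, interior_prod_eq, interior_Icc, interior_Icc]

lemma testFunction_eq_zero {V : Type} [NormedAddCommGroup V] [NormedSpace ℝ V] {Ω : Set V}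
    (χ : TestFunction (TopologicalSpace.Opens.interior Ω) ℝ ⊤) {p : V} (hp : p ∉ interior Ω) :
    χ p = 0 :=
  image_eq_zero_of_notMem_tsupport fun h => hp (χ.tsupport_subset h)

variable {n : ℕ} {a b : ℝ}

lemma integrable_L2_Icc (f : L2 n (Icc a b)) : IntegrableOn f (Icc a b) :=
  (Lp.memLp f).integrable (by norm_num)

lemma integrable_L2_box (f : L2 n (box a b)) :
    Integrable f ((volume.restrict (Icc (0 : ℝ) 1)).prod (volume.restrict (Icc a b))) := by
  rw [← volume_restrict_box]
  exact (Lp.memLp f).integrable (by norm_num)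

lemma isWeakDeriv_of_primitive (hab : a ≤ b) {f g : L2 n (Icc a b)} (c : E n)
    (h : ∀ᵐ x ∂(volume.restrict (Icc a b)), f x = c + ∫ θ in a..x, g θ) :
    IsWeakDeriv (1 : ℝ) f g := by
  intro χ
  have h1 := integral_deriv_smul_primitive hab (integrable_L2_Icc g) c (χ := χ)
    (χ.contDiff.of_le (by simp)) (testFunction_eq_zero χ (by simp))
    (testFunction_eq_zero χ (by simp))
  rw [eq_neg_iff_add_eq_zero, add_comm, ← eq_neg_iff_add_eq_zero, ← h1]
  refine integral_congr_ae ?_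
  filter_upwards [h] with x hx
  rw [hx, fderiv_apply_one_eq_deriv]

lemma isWeakDeriv_snd_of_primitive (hab : a ≤ b) {f g : L2 n (box a b)}
    (h : ∀ᵐ s ∂(volume.restrict (Icc (0 : ℝ) 1)), ∃ c : E n,
      ∀ᵐ x ∂(volume.restrict (Icc a b)), f (s, x) = c + ∫ θ in a..x, g (s, θ)) :
    IsWeakDeriv ((0 : ℝ), (1 : ℝ)) f g := by
  intro χ
  have hχd : Differentiable ℝ χ := χ.contDiff.differentiable (by simp)
  have i1 := integrable_test_smul g χ.contDiff.continuous χ.hasCompactSupport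
  have i2 := integrable_test_smul f (continuous_fderiv_test χ ((0 : ℝ), (1 : ℝ)))
    (hasCompactSupport_fderiv_test χ _)
  rw [integral_box i1, integral_box i2, ← integral_neg]
  refine integral_congr_ae ?_
  filter_upwards [h, (integrable_L2_box g).prod_right_ae] with s hs hgs
  obtain ⟨c, hc⟩ := hs
  have hχs : ContDiff ℝ 1 (fun x => χ (s, x)) :=
    (χ.contDiff.of_le (by simp)).comp (contDiff_const.prodMk contDiff_id)
  have h1 := integral_deriv_smul_primitive hab hgs c hχs
    (testFunction_eq_zero χ (by simp [interior_box])) (testFunction_eq_zero χ (by simp [interior_box]))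
  rw [eq_neg_iff_add_eq_zero, add_comm, ← eq_neg_iff_add_eq_zero, ← h1]
  refine integral_congr_ae ?_
  filter_upwards [hc] with x hx
  rw [hx]
  congr 1
  have := (hχd (s, x)).hasFDerivAt.comp_hasDerivAt x
    ((hasDerivAt_const x s).prodMk (hasDerivAt_id x))
  exact this.deriv.symm

lemma isWeakDeriv_fst_of_primitive {f g : L2 n (box a b)}
    (h : ∀ᵐ x ∂(volume.restrict (Icc a b)), ∃ c : E n,
      ∀ᵐ s ∂(volume.restrict (Icc (0 : ℝ) 1)), f (s, x) = c + ∫ θ in (0 : ℝ)..s, g (θ, x)) :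
    IsWeakDeriv ((1 : ℝ), (0 : ℝ)) f g := by
  intro χ
  have hχd : Differentiable ℝ χ := χ.contDiff.differentiable (by simp)
  have i1 := integrable_test_smul g χ.contDiff.continuous χ.hasCompactSupport
  have i2 := integrable_test_smul f (continuous_fderiv_test χ ((1 : ℝ), (0 : ℝ)))
    (hasCompactSupport_fderiv_test χ _)
  rw [integral_box_symm i1, integral_box_symm i2, ← integral_neg]
  refine integral_congr_ae ?_
  filter_upwards [h, (integrable_L2_box g).prod_left_ae] with x hs hgs
  obtain ⟨c, hc⟩ := hs
  have hχs : ContDiff ℝ 1 (fun s => χ (s, x)) :=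
    (χ.contDiff.of_le (by simp)).comp (contDiff_id.prodMk contDiff_const)
  have h1 := integral_deriv_smul_primitive zero_le_one hgs c hχs
    (testFunction_eq_zero χ (by simp [interior_box])) (testFunction_eq_zero χ (by simp [interior_box]))
  rw [eq_neg_iff_add_eq_zero, add_comm, ← eq_neg_iff_add_eq_zero, ← h1]
  refine integral_congr_ae ?_
  filter_upwards [hc] with s hs
  rw [hs]
  congr 1
  have := (hχd (s, x)).hasFDerivAt.comp_hasDerivAt s
    ((hasDerivAt_id s).prodMk (hasDerivAt_const s x))
  exact this.deriv.symm

/-- An integrable function on `Ω` that is orthogonal to all test functions vanishes. -/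
lemma ae_eq_zero_of_forall_testFunction {V : Type} [NormedAddCommGroup V] [NormedSpace ℝ V]
    [FiniteDimensional ℝ V] [MeasureSpace V] [BorelSpace V]
    {F : Type*} [NormedAddCommGroup F] [NormedSpace ℝ F] [CompleteSpace F]
    {Ω : Set V} (hΩ : volume (frontier Ω) = 0) {g : V → F} (hg : IntegrableOn g Ω)
    (h : ∀ χ : TestFunction (TopologicalSpace.Opens.interior Ω) ℝ ⊤, ∫ p in Ω, χ p • g p = 0) :
    g =ᵐ[volume.restrict Ω] 0 := by
  have hr : (volume : Measure V).restrict (interior Ω) = volume.restrict Ω :=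
    Measure.restrict_congr_set (interior_ae_eq_of_null_frontier hΩ)
  rw [← hr]
  rw [← hr] at h
  have h1 := isOpen_interior.ae_eq_zero_of_integral_contDiff_smul_eq_zero (U := interior Ω)
    (f := g) (μ := volume.restrict (interior Ω)) ?_ ?_
  · filter_upwards [h1, ae_restrict_mem isOpen_interior.measurableSet] with x hx hx'
    exact hx hx'
  · rw [hr]
    exact (Integrable.locallyIntegrable hg).locallyIntegrableOn _
  · intro η h1 h2 h3
    exact h ⟨η, h1, h2, h3⟩

lemma IsWeakDeriv.eq_zero {V : Type} [NormedAddCommGroup V] [NormedSpace ℝ V]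
    [FiniteDimensional ℝ V] [MeasureSpace V] [BorelSpace V] {Ω : Set V}
    [IsFiniteMeasure ((volume : Measure V).restrict Ω)]
    (hΩ : volume (frontier Ω) = 0) {e : V} {g : L2 n Ω} (h : IsWeakDeriv e 0 g) : g = 0 := by
  rw [Lp.eq_zero_iff_ae_eq_zero]
  refine ae_eq_zero_of_forall_testFunction hΩ ((Lp.memLp g).integrable (by norm_num)) fun χ => ?_
  rw [h χ, neg_eq_zero]
  refine integral_eq_zero_of_ae ?_
  filter_upwards [Lp.coeFn_zero (E n) 2 ((volume : Measure V).restrict Ω)] with p hp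
  rw [hp]
  simp

lemma volume_frontier_Icc : volume (frontier (Icc a b)) = 0 :=
  (convex_Icc a b).addHaar_frontier _

lemma volume_frontier_box : volume (frontier (box a b)) = 0 :=
  ((convex_Icc (0 : ℝ) 1).prod (convex_Icc a b)).addHaar_frontier _

/-! ### Functions with vanishing weak derivative -/

lemma exists_Icc_of_isCompact_subset_Ioo {a b : ℝ} {K : Set ℝ} (hK : IsCompact K)
    (h : K ⊆ Ioo a b) (hab : a < b) : ∃ α β, a < α ∧ β < b ∧ K ⊆ Icc α β := by
  rcases K.eq_empty_or_nonempty with rfl | hne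
  · obtain ⟨c, hc⟩ := exists_between hab
    exact ⟨c, c, hc.1, hc.2, empty_subset _⟩
  · obtain ⟨α, hα⟩ := hK.exists_isLeast hne
    obtain ⟨β, hβ⟩ := hK.exists_isGreatest hne
    exact ⟨α, β, (h hα.1).1, (h hβ.1).2, fun x hx => ⟨hα.2 hx, hβ.2 hx⟩⟩

/-- A test function of integral zero is the derivative of a test function. -/
lemma exists_testFunction_deriv_eq {a b : ℝ} (hab : a < b) {ζ : ℝ → ℝ}
    (hζ : ContDiff ℝ ((⊤ : ℕ∞) : WithTop ℕ∞) ζ) (hc : HasCompactSupport ζ)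
    (hs : tsupport ζ ⊆ Ioo a b) (h0 : ∫ x in a..b, ζ x = 0) :
    ∃ χ : TestFunction (TopologicalSpace.Opens.interior (Icc a b)) ℝ ⊤, deriv χ = ζ := by
  obtain ⟨α, β, hα, hβ, hK⟩ := exists_Icc_of_isCompact_subset_Ioo hc hs hab
  have hz : ∀ x, x ∉ Icc α β → ζ x = 0 := fun x hx =>
    image_eq_zero_of_notMem_tsupport fun h => hx (hK h)
  have hi : ∀ u v, IntervalIntegrable ζ volume u v := fun u v =>
    hζ.continuous.intervalIntegrable u v
  have hder : ∀ x, HasDerivAt (fun x => ∫ y in a..x, ζ y) (ζ x) x := fun x =>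
    intervalIntegral.integral_hasDerivAt_right (hi _ _)
      (hζ.continuous.stronglyMeasurableAtFilter _ _) hζ.continuous.continuousAt
  have hderiv : deriv (fun x => ∫ y in a..x, ζ y) = ζ := funext fun x => (hder x).deriv
  have hsupp : Function.support (fun x => ∫ y in a..x, ζ y) ⊆ Icc α β := by
    intro x hx
    by_contra hx'
    apply hx
    rcases not_and_or.mp hx' with h | h
    · push Not at h
      refine intervalIntegral.integral_zero_ae (Eventually.of_forall fun y hy => hz y ?_)
      rintro ⟨h1, -⟩
      rcases le_or_gt a x with hax | hax
      · rw [uIoc_of_le hax] at hy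
        linarith [hy.2]
      · rw [uIoc_of_ge hax.le] at hy
        linarith [hy.2]
    · push Not at h
      have h1 : ∫ y in b..x, ζ y = 0 := by
        refine intervalIntegral.integral_zero_ae (Eventually.of_forall fun y hy => hz y ?_)
        rintro ⟨-, h1⟩
        rcases le_or_gt b x with hax | hax
        · rw [uIoc_of_le hax] at hy
          linarith [hy.1]
        · rw [uIoc_of_ge hax.le] at hy
          linarith [hy.1]
      change ∫ y in a..x, ζ y = 0
      rw [← intervalIntegral.integral_add_adjacent_intervals (hi a b) (hi b x), h0, h1, add_zero]
  have hts : tsupport (fun x => ∫ y in a..x, ζ y) ⊆ Icc α β :=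
    closure_minimal hsupp isClosed_Icc
  refine ⟨⟨fun x => ∫ y in a..x, ζ y, ?_, ?_, ?_⟩, hderiv⟩
  · rw [contDiff_infty_iff_deriv, hderiv]
    exact ⟨fun x => (hder x).differentiableAt, hζ⟩
  · exact isCompact_Icc.of_isClosed_subset isClosed_closure hts
  · refine hts.trans fun x hx => ?_
    change x ∈ interior (Icc a b)
    rw [interior_Icc]
    exact ⟨hα.trans_le hx.1, hx.2.trans_lt hβ⟩

/-- The lemma of du Bois-Reymond: an integrable function whose weak derivative vanishes is
constant. -/
lemma ae_eq_const_of_forall_testFunction {F : Type*} [NormedAddCommGroup F] [NormedSpace ℝ F]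
    [CompleteSpace F] {a b : ℝ} (hab : a < b) {f : ℝ → F} (hf : IntegrableOn f (Icc a b))
    (h : ∀ χ : TestFunction (TopologicalSpace.Opens.interior (Icc a b)) ℝ ⊤,
      ∫ x in Icc a b, deriv χ x • f x = 0) :
    ∃ c : F, f =ᵐ[volume.restrict (Icc a b)] fun _ => c := by
  let B : ContDiffBump ((a + b) / 2) :=
    ⟨(b - a) / 8, (b - a) / 4, by linarith, by linarith⟩
  set ρ : ℝ → ℝ := B.normed volume with hρ
  have hρc : Continuous ρ := B.continuous_normed
  have hρs : tsupport ρ ⊆ Ioo a b := by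
    rw [hρ, B.tsupport_normed_eq, Real.closedBall_eq_Icc]
    intro x hx
    have h1 := hx.1
    have h2 := hx.2
    change (a + b) / 2 - (b - a) / 4 ≤ x at h1
    change x ≤ (a + b) / 2 + (b - a) / 4 at h2
    constructor <;> linarith
  have hρI : ∫ x in a..b, ρ x = 1 := by
    rw [intervalIntegral.integral_of_le hab.le, ← integral_Icc_eq_integral_Ioc,
      setIntegral_eq_integral_of_forall_compl_eq_zero]
    · exact B.integral_normed
    · intro x hx
      exact image_eq_zero_of_notMem_tsupport fun h => hx (Ioo_subset_Icc_self (hρs h))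
  have hint : ∀ η : ℝ → ℝ, Continuous η → IntegrableOn (fun x => η x • f x) (Icc a b) :=
    fun η hη => hf.continuousOn_smul hη.continuousOn isCompact_Icc
  refine ⟨∫ x in Icc a b, ρ x • f x, ?_⟩
  set c := ∫ x in Icc a b, ρ x • f x with hc
  have hfc : IntegrableOn (fun x => f x - c) (Icc a b) := hf.sub (integrable_const c)
  have key : (fun x => f x - c) =ᵐ[volume.restrict (Icc a b)] 0 := by
    refine ae_eq_zero_of_forall_testFunction volume_frontier_Icc hfc fun η => ?_
    have hηc : Continuous η := η.contDiff.continuous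
    have hηs : tsupport η ⊆ Ioo a b := by
      have := η.tsupport_subset
      change tsupport η ⊆ interior (Icc a b) at this
      rwa [interior_Icc] at this
    set I := ∫ x in a..b, η x with hI
    obtain ⟨χ, hχ⟩ := exists_testFunction_deriv_eq hab (ζ := fun x => η x - I * ρ x)
      (η.contDiff.sub (contDiff_const.mul B.contDiff_normed))
      (η.hasCompactSupport.sub B.hasCompactSupport_normed.mul_left)
      ((tsupport_sub _ _).trans (union_subset hηs
        ((closure_mono (Function.support_mul_subset_right _ _)).trans hρs)))
      (by
        rw [intervalIntegral.integral_sub (hηc.intervalIntegrable _ _)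
          ((hρc.intervalIntegrable _ _).const_mul I),
          intervalIntegral.integral_const_mul, hρI, mul_one, sub_self])
    have h1 := h χ
    rw [hχ] at h1
    simp only [sub_smul, mul_smul] at h1
    have hI' : IntegrableOn (fun x => I • ρ x • f x) (Icc a b) := (hint ρ hρc).smul I
    rw [integral_sub (hint η hηc) hI', integral_smul, ← hc] at h1
    simp only [smul_sub]
    have hη' : IntegrableOn (fun x => η x • c) (Icc a b) :=
      (hηc.smul continuous_const).integrableOn_Icc
    rw [integral_sub (hint η hηc) hη',
      integral_smul_const, integral_Icc_eq_integral_Ioc (f := η),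
      ← intervalIntegral.integral_of_le hab.le, ← hI]
    exact h1
  filter_upwards [key] with x hx
  exact sub_eq_zero.mp hx

/-! ### Matrix-vector products -/

section Mat

variable {n m : ℕ}

/-- A square matrix acting on `ℝⁿ`. -/
def matCLM (M : Matrix (Fin n) (Fin n) ℝ) : E n →L[ℝ] E n := Matrix.toEuclideanCLM (𝕜 := ℝ) M

lemma mulE_eq_matCLM (M : Matrix (Fin n) (Fin n) ℝ) (v : E n) : mulE M v.ofLp = matCLM M v := rfl

lemma matCLM_one : matCLM (1 : Matrix (Fin n) (Fin n) ℝ) = ContinuousLinearMap.id ℝ (E n) :=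
  map_one (Matrix.toEuclideanCLM (𝕜 := ℝ))

lemma matCLM_zero : matCLM (0 : Matrix (Fin n) (Fin n) ℝ) = 0 :=
  map_zero (Matrix.toEuclideanCLM (𝕜 := ℝ))

lemma matCLM_add (M N : Matrix (Fin n) (Fin n) ℝ) : matCLM (M + N) = matCLM M + matCLM N :=
  map_add (Matrix.toEuclideanCLM (𝕜 := ℝ)) M N

lemma matCLM_smul (r : ℝ) (M : Matrix (Fin n) (Fin n) ℝ) : matCLM (r • M) = r • matCLM M :=
  map_smul (Matrix.toEuclideanCLM (𝕜 := ℝ)) r M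

lemma matCLM_mul_apply (M N : Matrix (Fin n) (Fin n) ℝ) (v : E n) :
    matCLM (M * N) v = matCLM M (matCLM N v) := by
  rw [matCLM, map_mul]; rfl

lemma continuous_matCLM : Continuous (matCLM (n := n)) :=
  LinearMap.continuous_of_finiteDimensional
    ((Matrix.toEuclideanCLM (𝕜 := ℝ) (n := Fin n)).toAlgEquiv.toLinearMap)

/-- The `j`-th block of a block row. -/
def blk (M : Matrix (Fin n) (Fin m × Fin n) ℝ) (j : Fin m) : Matrix (Fin n) (Fin n) ℝ :=
  Matrix.of fun i k => M i (j, k)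

lemma mulE_stack (M : Matrix (Fin n) (Fin m × Fin n) ℝ) (w : Fin m → E n) :
    mulE M (stack w) = ∑ j, matCLM (blk M j) (w j) := by
  ext i
  simp only [mulE, mulVec, dotProduct, Fintype.sum_prod_type, stack, ← mulE_eq_matCLM,
    WithLp.ofLp_sum, Finset.sum_apply, blk, Matrix.of_apply]

lemma mul_blockCol (M : Matrix (Fin n) (Fin m × Fin n) ℝ) (R : Fin m → Matrix (Fin n) (Fin n) ℝ) :
    M * blockCol R = ∑ j, blk M j * R j := by
  ext i k
  simp only [Matrix.mul_apply, Fintype.sum_prod_type, blockCol, Matrix.sum_apply, blk,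
    Matrix.of_apply]

lemma mulE_mul_blockCol (M : Matrix (Fin n) (Fin m × Fin n) ℝ)
    (R : Fin m → Matrix (Fin n) (Fin n) ℝ) (v : E n) :
    mulE (M * blockCol R) v.ofLp = mulE M (stack fun j => matCLM (R j) v) := by
  rw [mulE_stack, mul_blockCol, mulE_eq_matCLM, matCLM, map_sum, _root_.sum_apply]
  exact Finset.sum_congr rfl fun j _ => matCLM_mul_apply _ _ _

lemma blk_blockRow (R : Fin m → Matrix (Fin n) (Fin n) ℝ) (j : Fin m) :
    blk (blockRow R) j = R j := rfl

lemma mulE_mul {k l : Type} [Fintype k] [Fintype l] (M : Matrix (Fin n) k ℝ) (N : Matrix k l ℝ)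
    (v : l → ℝ) : mulE (M * N) v = mulE M (N *ᵥ v) := by
  rw [mulE, mulE, Matrix.mulVec_mulVec]

lemma integral_mulE_stack {X : Type*} [MeasurableSpace X] {μ : Measure X}
    (M : Matrix (Fin n) (Fin m × Fin n) ℝ) {w : X → Fin m → E n}
    (hw : ∀ j, Integrable (fun x => w x j) μ) :
    ∫ x, mulE M (stack (w x)) ∂μ = mulE M (stack fun j => ∫ x, w x j ∂μ) := by
  simp only [mulE_stack]
  rw [integral_finsetSum _ fun j _ => (matCLM (blk M j)).integrable_comp (hw j)]
  exact Finset.sum_congr rfl fun j _ => (matCLM (blk M j)).integral_comp_comm (hw j)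

lemma integrable_mulE_stack {X : Type*} [MeasurableSpace X] {μ : Measure X}
    (M : Matrix (Fin n) (Fin m × Fin n) ℝ) {w : X → Fin m → E n}
    (hw : ∀ j, Integrable (fun x => w x j) μ) :
    Integrable (fun x => mulE M (stack (w x))) μ := by
  simp only [mulE_stack]
  exact integrable_finsetSum _ fun j _ => (matCLM (blk M j)).integrable_comp (hw j)

lemma mulE_stack_add (M : Matrix (Fin n) (Fin m × Fin n) ℝ) (w w' : Fin m → E n) :
    mulE M (stack (w + w')) = mulE M (stack w) + mulE M (stack w') := by
  simp only [mulE_stack, Pi.add_apply, map_add, Finset.sum_add_distrib]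

end Mat

/-! ### The kernels -/

section Kernels

variable {n : ℕ} {a b : ℝ} {B : Matrix (Fin 2 × Fin n) (Fin 4 × Fin n) ℝ}

/-- The coefficients `(c, d)` of the affine part of `𝒯₁ v`. -/
def affCoeff (a b : ℝ) (B : Matrix (Fin 2 × Fin n) (Fin 4 × Fin n) ℝ) (v : ℝ → E n) (i : Fin 2) :
    E n :=
  WithLp.toLp 2 fun k =>
    (-((B * Hmat n a b)⁻¹ * B) *ᵥ
      stack ![0, 0, ∫ θ in Icc a b, (b - θ) • v θ, ∫ θ in Icc a b, v θ]) (i, k)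

lemma stack_affCoeff (v : ℝ → E n) : stack (affCoeff a b B v) = -((B * Hmat n a b)⁻¹ * B) *ᵥ
      stack ![0, 0, ∫ θ in Icc a b, (b - θ) • v θ, ∫ θ in Icc a b, v θ] := rfl

lemma Hmat_mulVec_stack_apply (c : Fin 2 → E n) (i : Fin 4) (k : Fin n) :
    (Hmat n a b *ᵥ stack c) (i, k) =
      ((!![1, 0; 0, 1; 1, (b - a) • (1 : Matrix (Fin n) (Fin n) ℝ); 0, 1] :
          Matrix (Fin 4) (Fin 2) (Matrix (Fin n) (Fin n) ℝ)) i 0 *ᵥ (c 0).ofLp) k +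
        ((!![1, 0; 0, 1; 1, (b - a) • (1 : Matrix (Fin n) (Fin n) ℝ); 0, 1] :
          Matrix (Fin 4) (Fin 2) (Matrix (Fin n) (Fin n) ℝ)) i 1 *ᵥ (c 1).ofLp) k := by
  rw [mulVec, dotProduct, Fintype.sum_prod_type, Fin.sum_univ_two]
  rfl

lemma Hmat_mulVec_stack (c : Fin 2 → E n) :
    Hmat n a b *ᵥ stack c = stack ![c 0, c 1, c 0 + (b - a) • c 1, c 1] := by
  ext ⟨i, k⟩
  rw [Hmat_mulVec_stack_apply]
  fin_cases i
  · change ((1 : Matrix (Fin n) (Fin n) ℝ) *ᵥ (c 0).ofLp) k +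
      ((0 : Matrix (Fin n) (Fin n) ℝ) *ᵥ (c 1).ofLp) k = (c 0).ofLp k
    rw [one_mulVec, zero_mulVec, Pi.zero_apply, add_zero]
  · change ((0 : Matrix (Fin n) (Fin n) ℝ) *ᵥ (c 0).ofLp) k +
      ((1 : Matrix (Fin n) (Fin n) ℝ) *ᵥ (c 1).ofLp) k = (c 1).ofLp k
    rw [one_mulVec, zero_mulVec, Pi.zero_apply, zero_add]
  · change ((1 : Matrix (Fin n) (Fin n) ℝ) *ᵥ (c 0).ofLp) k +
      (((b - a) • (1 : Matrix (Fin n) (Fin n) ℝ)) *ᵥ (c 1).ofLp) k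
        = (c 0).ofLp k + (b - a) * (c 1).ofLp k
    rw [one_mulVec, smul_mulVec, one_mulVec, Pi.smul_apply, smul_eq_mul]
  · change ((0 : Matrix (Fin n) (Fin n) ℝ) *ᵥ (c 0).ofLp) k +
      ((1 : Matrix (Fin n) (Fin n) ℝ) *ᵥ (c 1).ofLp) k = (c 1).ofLp k
    rw [one_mulVec, zero_mulVec, Pi.zero_apply, zero_add]

lemma mulVec_boundary_eq_zero (hB : IsUnit (B * Hmat n a b)) (v : ℝ → E n) :
    B *ᵥ stack ![affCoeff a b B v 0, affCoeff a b B v 1,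
      affCoeff a b B v 0 + (b - a) • affCoeff a b B v 1 + ∫ θ in Icc a b, (b - θ) • v θ,
      affCoeff a b B v 1 + ∫ θ in Icc a b, v θ] = 0 := by
  have h : stack ![affCoeff a b B v 0, affCoeff a b B v 1,
      affCoeff a b B v 0 + (b - a) • affCoeff a b B v 1 + ∫ θ in Icc a b, (b - θ) • v θ,
      affCoeff a b B v 1 + ∫ θ in Icc a b, v θ] =
      Hmat n a b *ᵥ stack (affCoeff a b B v) +
        stack ![0, 0, ∫ θ in Icc a b, (b - θ) • v θ, ∫ θ in Icc a b, v θ] := by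
    rw [Hmat_mulVec_stack]
    ext ⟨i, k⟩
    fin_cases i
    · exact (add_zero _).symm
    · exact (add_zero _).symm
    · rfl
    · rfl
  rw [h, mulVec_add, mulVec_mulVec, stack_affCoeff, mulVec_mulVec, Matrix.mul_neg,
    ← Matrix.mul_assoc, Matrix.mul_nonsing_inv _ ((Matrix.isUnit_iff_isUnit_det _).mp hB),
    Matrix.one_mul, neg_mulVec, neg_add_cancel]

/-- `∂ₓT₂(x,θ)`, which does not depend on `x`. -/
def kerT2x (a b : ℝ) (B : Matrix (Fin 2 × Fin n) (Fin 4 × Fin n) ℝ) (θ : ℝ) :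
    Matrix (Fin n) (Fin n) ℝ :=
  -((blockRow ![0, 1] : Matrix (Fin n) (Fin 2 × Fin n) ℝ) * (B * Hmat n a b)⁻¹ * B * Qmat n b θ)

lemma kerT2_eq (x θ : ℝ) :
    kerT2 a b B x θ = kerT2 a b B a θ + (x - a) • kerT2x a b B θ := by
  have : Kmat n a x = Kmat n a a + (x - a) • (blockRow ![0, 1] : Matrix (Fin n) (Fin 2 × Fin n) ℝ) := by
    ext i ⟨j, k⟩
    fin_cases j
    · change (1 : Matrix (Fin n) (Fin n) ℝ) i k
        = (1 : Matrix (Fin n) (Fin n) ℝ) i k + (x - a) * 0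
      ring
    · change (x - a) * (1 : Matrix (Fin n) (Fin n) ℝ) i k
        = (a - a) * (1 : Matrix (Fin n) (Fin n) ℝ) i k + (x - a) * (1 : Matrix (Fin n) (Fin n) ℝ) i k
      ring
  rw [kerT2, this, kerT2, kerT2x]
  simp only [Matrix.add_mul, Matrix.smul_mul, smul_neg, neg_add]

lemma dxKer_kerT2 (x θ : ℝ) : dxKer (kerT2 a b B) x θ = kerT2x a b B θ := by
  ext i j
  have : (fun y => kerT2 a b B y θ i j) =
      fun y => kerT2 a b B a θ i j + (y - a) * kerT2x a b B θ i j := by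
    ext y
    rw [kerT2_eq]
    rfl
  simp only [dxKer, Matrix.of_apply, this]
  have h := (((hasDerivAt_id x).sub_const a).mul_const (kerT2x a b B θ i j)).const_add
    (kerT2 a b B a θ i j)
  rw [one_mul] at h
  exact h.deriv

lemma dxKer_kerT1 (x θ : ℝ) : dxKer (kerT1 a b B) x θ = 1 + kerT2x a b B θ := by
  ext i j
  have : (fun y => kerT1 a b B y θ i j) =
      fun y => (y - θ) * (1 : Matrix (Fin n) (Fin n) ℝ) i j +
        (kerT2 a b B a θ i j + (y - a) * kerT2x a b B θ i j) := by
    ext y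
    rw [kerT1, kerT2_eq]
    rfl
  simp only [dxKer, Matrix.of_apply, this]
  have h := (((hasDerivAt_id x).sub_const θ).mul_const ((1 : Matrix (Fin n) (Fin n) ℝ) i j)).add
    ((((hasDerivAt_id x).sub_const a).mul_const (kerT2x a b B θ i j)).const_add
    (kerT2 a b B a θ i j))
  rw [one_mul, one_mul] at h
  exact h.deriv

lemma continuous_Qmat : Continuous (Qmat n b) := by
  refine continuous_matrix fun i j => ?_
  obtain ⟨i, k⟩ := i
  fin_cases i
  · exact continuous_const
  · exact continuous_const
  · exact (continuous_const.sub continuous_id).mul continuous_const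
  · exact continuous_const

lemma continuous_kerT2_left : Continuous (kerT2 a b B a) := by
  unfold kerT2
  exact (continuous_const.matrix_mul continuous_Qmat).neg

lemma continuous_kerT2x : Continuous (kerT2x a b B) := by
  unfold kerT2x
  exact (continuous_const.matrix_mul continuous_Qmat).neg

lemma continuous_kerT2 : Continuous fun q : ℝ × ℝ => kerT2 a b B q.1 q.2 := by
  have : (fun q : ℝ × ℝ => kerT2 a b B q.1 q.2)
      = fun q => kerT2 a b B a q.2 + (q.1 - a) • kerT2x a b B q.2 := funext fun q => kerT2_eq _ _
  rw [this]
  have h1 := (continuous_kerT2_left (a := a) (b := b) (B := B)).comp (continuous_snd (X := ℝ))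
  have h2 := (continuous_kerT2x (a := a) (b := b) (B := B)).comp (continuous_snd (X := ℝ))
  exact h1.add ((continuous_fst.sub continuous_const).smul h2)

/-- The kernel `κ` is measurable, and bounded on the square `[a,b]²`. -/
def IsBddKer (a b : ℝ) (κ : ℝ × ℝ → E n →L[ℝ] E n) : Prop :=
  StronglyMeasurable κ ∧ ∃ C, ∀ x ∈ Icc a b, ∀ θ ∈ Icc a b, ‖κ (x, θ)‖ ≤ C

lemma isBddKer_ite {κ₁ κ₂ : ℝ × ℝ → E n →L[ℝ] E n} (h₁ : Continuous κ₁) (h₂ : Continuous κ₂) :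
    IsBddKer a b fun q => if q.2 ≤ q.1 then κ₁ q else κ₂ q := by
  refine ⟨StronglyMeasurable.ite (measurableSet_le measurable_snd measurable_fst)
    h₁.stronglyMeasurable h₂.stronglyMeasurable, ?_⟩
  have hc : IsCompact (Icc a b ×ˢ Icc a b) := isCompact_Icc.prod isCompact_Icc
  obtain ⟨C₁, hC₁⟩ := hc.exists_bound_of_continuousOn h₁.continuousOn
  obtain ⟨C₂, hC₂⟩ := hc.exists_bound_of_continuousOn h₂.continuousOn
  refine ⟨max C₁ C₂, fun x hx θ hθ => ?_⟩
  dsimp only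
  split_ifs
  · exact (hC₁ (x, θ) ⟨hx, hθ⟩).trans (le_max_left _ _)
  · exact (hC₂ (x, θ) ⟨hx, hθ⟩).trans (le_max_right _ _)

lemma IsBddKer.integrableOn {κ : ℝ × ℝ → E n →L[ℝ] E n} (hκ : IsBddKer a b κ) {v : ℝ → E n}
    (hv : IntegrableOn v (Icc a b)) {x : ℝ} (hx : x ∈ Icc a b) :
    IntegrableOn (fun θ => κ (x, θ) (v θ)) (Icc a b) := by
  obtain ⟨hm, C, hC⟩ := hκ
  refine (hv.norm.const_mul C).mono' ?_ ?_
  · exact (ContinuousLinearMap.id ℝ (E n →L[ℝ] E n)).aestronglyMeasurable_comp₂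
      (hm.comp_measurable measurable_prodMk_left).aestronglyMeasurable hv.1
  · filter_upwards [ae_restrict_mem measurableSet_Icc] with θ hθ
    exact (κ (x, θ)).le_of_opNorm_le (hC x hx θ hθ) _

/-- The kernel of `𝒯₁`. -/
def ker0 (a b : ℝ) (B : Matrix (Fin 2 × Fin n) (Fin 4 × Fin n) ℝ) (q : ℝ × ℝ) : E n →L[ℝ] E n :=
  if q.2 ≤ q.1 then matCLM (kerT1 a b B q.1 q.2) else matCLM (kerT2 a b B q.1 q.2)

/-- The kernel of `∂ₓ𝒯₁`. -/
def ker1 (a b : ℝ) (B : Matrix (Fin 2 × Fin n) (Fin 4 × Fin n) ℝ) (q : ℝ × ℝ) : E n →L[ℝ] E n :=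
  if q.2 ≤ q.1 then matCLM (1 + kerT2x a b B q.2) else matCLM (kerT2x a b B q.2)

lemma isBddKer_ker0 : IsBddKer a b (ker0 a b B) := by
  refine isBddKer_ite (continuous_matCLM.comp ?_) (continuous_matCLM.comp continuous_kerT2)
  unfold kerT1
  exact ((continuous_fst.sub continuous_snd).smul continuous_const).add continuous_kerT2

lemma isBddKer_ker1 : IsBddKer a b (ker1 a b B) := by
  have h := (continuous_kerT2x (a := a) (b := b) (B := B)).comp (continuous_snd (X := ℝ))
  exact isBddKer_ite (continuous_matCLM.comp (continuous_const.add h)) (continuous_matCLM.comp h)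

/-- The integral operator on `[a,b]` with kernel `κ`. -/
def intOp (a b : ℝ) (κ : ℝ × ℝ → E n →L[ℝ] E n) (v : ℝ → E n) (x : ℝ) : E n :=
  ∫ θ in Icc a b, κ (x, θ) (v θ)

end Kernels

/-! ### The integral operators `𝒯₁` and `∂ₓ𝒯₁` -/

section IntOp

variable {n : ℕ} {a b : ℝ} {B : Matrix (Fin 2 × Fin n) (Fin 4 × Fin n) ℝ}

lemma intervalIntegral_add_eq_setIntegral_ite {x : ℝ} (hx : x ∈ Icc a b) {f₁ f₂ : ℝ → E n}
    (hf : IntegrableOn (fun θ => if θ ≤ x then f₁ θ else f₂ θ) (Icc a b)) :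
    (∫ θ in a..x, f₁ θ) + ∫ θ in x..b, f₂ θ = ∫ θ in Icc a b, if θ ≤ x then f₁ θ else f₂ θ := by
  have hab : a ≤ b := hx.1.trans hx.2
  have hi : ∀ u ∈ Icc a b, ∀ v ∈ Icc a b, u ≤ v →
      IntervalIntegrable (fun θ => if θ ≤ x then f₁ θ else f₂ θ) volume u v := by
    intro u hu v hv huv
    rw [intervalIntegrable_iff_integrableOn_Icc_of_le huv]
    exact hf.mono_set (Icc_subset_Icc hu.1 hv.2)
  rw [integral_Icc_eq_integral_Ioc, ← intervalIntegral.integral_of_le hab,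
    ← intervalIntegral.integral_add_adjacent_intervals (hi a ⟨le_rfl, hab⟩ x hx hx.1)
      (hi x hx b ⟨hab, le_rfl⟩ hx.2)]
  congr 1
  · refine intervalIntegral.integral_congr fun θ hθ => ?_
    rw [uIcc_of_le hx.1] at hθ
    simp only [if_pos hθ.2]
  · rw [intervalIntegral.integral_of_le hx.2, intervalIntegral.integral_of_le hx.2]
    refine setIntegral_congr_fun measurableSet_Ioc fun θ hθ => ?_
    simp only [if_neg (not_le.mpr hθ.1)]

lemma ker0_apply_ite (x θ : ℝ) (v : E n) : ker0 a b B (x, θ) v =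
    if θ ≤ x then mulE (kerT1 a b B x θ) v.ofLp else mulE (kerT2 a b B x θ) v.ofLp := by
  unfold ker0
  split_ifs <;> rfl

lemma opT1_eq_intOp {v : ℝ → E n} (hv : IntegrableOn v (Icc a b)) {x : ℝ} (hx : x ∈ Icc a b) :
    opT1 a b B v x = intOp a b (ker0 a b B) v x := by
  have h := (isBddKer_ker0 (B := B)).integrableOn hv hx
  simp only [ker0_apply_ite] at h
  simp only [opT1, threePI, intOp, ker0_apply_ite]
  rw [← intervalIntegral_add_eq_setIntegral_ite hx h, Pi.zero_apply, mulE_eq_matCLM, matCLM_zero,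
    _root_.zero_apply, zero_add]

lemma opA11_eq {v : ℝ → E n} (hv : IntegrableOn v (Icc a b)) {x : ℝ} (hx : x ∈ Icc a b)
    (A : ℝ → Matrix (Fin n) (Fin 3 × Fin n) ℝ) :
    opA11 a b B A v x = mulE (A x)
      (stack ![intOp a b (ker0 a b B) v x, intOp a b (ker1 a b B) v x, v x]) := by
  have h0 := (isBddKer_ker0 (B := B)).integrableOn hv hx
  have h1 := (isBddKer_ker1 (B := B)).integrableOn hv hx
  set w : ℝ → Fin 3 → E n := fun θ => ![ker0 a b B (x, θ) (v θ), ker1 a b B (x, θ) (v θ), 0] with hw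
  have hwi : ∀ j, IntegrableOn (fun θ => w θ j) (Icc a b) := by
    intro j
    fin_cases j
    · exact h0
    · exact h1
    · exact integrableOn_zero
  have hite : ∀ θ, (if θ ≤ x then
      mulE (A x * blockCol ![kerT1 a b B x θ, dxKer (kerT1 a b B) x θ, 0]) (v θ).ofLp
      else mulE (A x * blockCol ![kerT2 a b B x θ, dxKer (kerT2 a b B) x θ, 0]) (v θ).ofLp)
      = mulE (A x) (stack (w θ)) := by
    intro θ
    rw [mulE_mul_blockCol, mulE_mul_blockCol, dxKer_kerT1, dxKer_kerT2, ← apply_ite (mulE (A x)),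
      ← apply_ite stack]
    congr 2
    ext1 j
    split_ifs with hθ
    · fin_cases j
      · change _ = ker0 a b B (x, θ) (v θ)
        rw [ker0, if_pos hθ]; rfl
      · change _ = ker1 a b B (x, θ) (v θ)
        rw [ker1, if_pos hθ]; rfl
      · change matCLM 0 (v θ) = 0
        rw [matCLM_zero]; rfl
    · fin_cases j
      · change _ = ker0 a b B (x, θ) (v θ)
        rw [ker0, if_neg hθ]; rfl
      · change _ = ker1 a b B (x, θ) (v θ)
        rw [ker1, if_neg hθ]; rfl
      · change matCLM 0 (v θ) = 0
        rw [matCLM_zero]; rfl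
  simp only [opA11, threePI]
  rw [add_assoc, intervalIntegral_add_eq_setIntegral_ite hx]
  · simp only [hite]
    rw [integral_mulE_stack _ hwi]
    refine (congrArg (· + _) (mulE_mul_blockCol (A x) ![0, 0, 1] (v x))).trans ?_
    rw [← mulE_stack_add]
    congr 2
    ext1 j
    fin_cases j
    · change matCLM 0 (v x) + intOp a b (ker0 a b B) v x = intOp a b (ker0 a b B) v x
      rw [matCLM_zero, _root_.zero_apply, zero_add]
    · change matCLM 0 (v x) + intOp a b (ker1 a b B) v x = intOp a b (ker1 a b B) v x
      rw [matCLM_zero, _root_.zero_apply, zero_add]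
    · change matCLM 1 (v x) + ∫ _ in Icc a b, (0 : E n) = v x
      rw [matCLM_one, integral_zero, add_zero]; rfl
  · simp only [hite]
    exact integrable_mulE_stack _ hwi

lemma integrableOn_sub_smul {v : ℝ → E n} (hv : IntegrableOn v (Icc a b)) (c : ℝ) :
    IntegrableOn (fun θ => (c - θ) • v θ) (Icc a b) :=
  hv.continuousOn_smul (continuous_const.sub continuous_id).continuousOn isCompact_Icc

lemma integral_affine_kernel {v : ℝ → E n} (hv : IntegrableOn v (Icc a b))
    (M : Matrix (Fin n) (Fin 2 × Fin n) ℝ) :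
    ∫ θ in Icc a b, matCLM (-(M * (B * Hmat n a b)⁻¹ * B * Qmat n b θ)) (v θ)
      = mulE M (stack (affCoeff a b B v)) := by
  set w : ℝ → Fin 4 → E n := fun θ => ![0, 0, (b - θ) • v θ, v θ] with hw
  have hwi : ∀ j, IntegrableOn (fun θ => w θ j) (Icc a b) := by
    intro j
    fin_cases j
    · exact integrableOn_zero
    · exact integrableOn_zero
    · exact integrableOn_sub_smul hv b
    · exact hv
  have h1 : ∀ θ, matCLM (-(M * (B * Hmat n a b)⁻¹ * B * Qmat n b θ)) (v θ)
      = mulE (-(M * (B * Hmat n a b)⁻¹ * B)) (stack (w θ)) := by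
    intro θ
    rw [← Matrix.neg_mul, ← mulE_eq_matCLM, Qmat, mulE_mul_blockCol]
    congr 2
    ext1 j
    fin_cases j
    · change matCLM 0 (v θ) = 0
      rw [matCLM_zero]; rfl
    · change matCLM 0 (v θ) = 0
      rw [matCLM_zero]; rfl
    · change matCLM ((b - θ) • 1) (v θ) = (b - θ) • v θ
      rw [matCLM_smul, matCLM_one]; rfl
    · change matCLM 1 (v θ) = v θ
      rw [matCLM_one]; rfl
  simp only [h1]
  rw [integral_mulE_stack _ hwi, stack_affCoeff, Matrix.mul_assoc, ← Matrix.mul_neg, mulE_mul]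
  congr 3
  ext1 j
  fin_cases j
  · exact integral_zero _ _
  · exact integral_zero _ _
  · rfl
  · rfl

lemma integral_kerT2x {v : ℝ → E n} (hv : IntegrableOn v (Icc a b)) :
    ∫ θ in Icc a b, matCLM (kerT2x a b B θ) (v θ) = affCoeff a b B v 1 := by
  refine (integral_affine_kernel hv _).trans ?_
  rw [mulE_stack, Fin.sum_univ_two, blk_blockRow, blk_blockRow]
  change matCLM 0 _ + matCLM 1 _ = _
  rw [matCLM_zero, matCLM_one, _root_.zero_apply, zero_add]
  rfl

lemma integral_kerT2_left {v : ℝ → E n} (hv : IntegrableOn v (Icc a b)) :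
    ∫ θ in Icc a b, matCLM (kerT2 a b B a θ) (v θ) = affCoeff a b B v 0 := by
  refine (integral_affine_kernel hv _).trans ?_
  rw [mulE_stack, Fin.sum_univ_two, Kmat, blk_blockRow, blk_blockRow]
  change matCLM 1 _ + matCLM ((a - a) • 1) _ = _
  rw [sub_self, zero_smul, matCLM_zero, matCLM_one, _root_.zero_apply, add_zero]
  rfl

lemma isBddKer_continuous_snd {R : ℝ → Matrix (Fin n) (Fin n) ℝ} (hR : Continuous R) :
    IsBddKer a b fun q => matCLM (R q.2) := by
  have h : Continuous fun q : ℝ × ℝ => matCLM (R q.2) :=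
    continuous_matCLM.comp (hR.comp continuous_snd)
  have := isBddKer_ite (a := a) (b := b) h h
  simpa only [ite_self] using this

lemma integrableOn_ite {v : ℝ → E n} (hv : IntegrableOn v (Icc a b)) (x : ℝ) :
    IntegrableOn (fun θ => if θ ≤ x then v θ else 0) (Icc a b) := by
  refine (hv.indicator (measurableSet_Iic (a := x))).congr (Eventually.of_forall fun θ => ?_)
  simp [indicator]

lemma intOp_ker1_eq {v : ℝ → E n} (hv : IntegrableOn v (Icc a b)) {x : ℝ} (hx : x ∈ Icc a b) :
    intOp a b (ker1 a b B) v x = affCoeff a b B v 1 + ∫ θ in a..x, v θ := by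
  have h : ∀ θ, ker1 a b B (x, θ) (v θ)
      = matCLM (kerT2x a b B θ) (v θ) + if θ ≤ x then v θ else 0 := by
    intro θ
    unfold ker1
    split_ifs
    · rw [matCLM_add, matCLM_one, add_comm]; rfl
    · rw [add_zero]
  simp only [intOp, h]
  rw [integral_add ((isBddKer_continuous_snd continuous_kerT2x).integrableOn hv hx)
    (integrableOn_ite hv x), integral_kerT2x hv, intervalIntegral_left_eq_setIntegral_ite hx]

lemma intOp_ker0_eq_affine {v : ℝ → E n} (hv : IntegrableOn v (Icc a b)) {x : ℝ}
    (hx : x ∈ Icc a b) : intOp a b (ker0 a b B) v x =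
      affCoeff a b B v 0 + (x - a) • affCoeff a b B v 1 + ∫ θ in a..x, (x - θ) • v θ := by
  have h : ∀ θ, ker0 a b B (x, θ) (v θ)
      = (matCLM (kerT2 a b B a θ) (v θ) + (x - a) • matCLM (kerT2x a b B θ) (v θ)) +
        if θ ≤ x then (x - θ) • v θ else 0 := by
    intro θ
    unfold ker0
    dsimp only
    rw [kerT1, matCLM_add, matCLM_smul, matCLM_one, kerT2_eq, matCLM_add, matCLM_smul]
    split_ifs
    · rw [add_comm]; rfl
    · rw [add_zero]; rfl
  have i0 : IntegrableOn (fun θ => matCLM (kerT2 a b B a θ) (v θ)) (Icc a b) :=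
    (isBddKer_continuous_snd continuous_kerT2_left).integrableOn hv hx
  have i1 : IntegrableOn (fun θ => (x - a) • matCLM (kerT2x a b B θ) (v θ)) (Icc a b) :=
    ((isBddKer_continuous_snd continuous_kerT2x).integrableOn hv hx).smul (x - a)
  have i2 := integrableOn_ite (integrableOn_sub_smul hv x) x
  simp only [intOp, h]
  rw [integral_add (by exact i0.add i1) i2, integral_add i0 i1, integral_smul, integral_kerT2x hv,
    integral_kerT2_left hv, intervalIntegral_left_eq_setIntegral_ite hx]

lemma integral_sub_smul_eq {v : ℝ → E n} (hv : IntegrableOn v (Icc a b)) {x : ℝ}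
    (hx : x ∈ Icc a b) : ∫ θ in a..x, (x - θ) • v θ = ∫ y in a..x, ∫ θ in a..y, v θ := by
  have hχ : ContDiff ℝ 1 fun y : ℝ => y - x := contDiff_id.sub contDiff_const
  have h := integral_deriv_smul_integral (hv.mono_set (Icc_subset_Icc le_rfl hx.2)) hχ (sub_self x)
  have hd : deriv (fun y : ℝ => y - x) = fun _ => 1 := by
    ext y
    simp
  rw [hd] at h
  simp only [one_smul] at h
  rw [intervalIntegral.integral_of_le hx.1, intervalIntegral.integral_of_le hx.1,
    ← integral_Icc_eq_integral_Ioc, ← integral_Icc_eq_integral_Ioc, h, ← integral_neg]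
  refine integral_congr_ae (Eventually.of_forall fun θ => ?_)
  dsimp only
  rw [← neg_smul, neg_sub]

lemma continuousOn_primitive {v : ℝ → E n} (hab : a ≤ b) (hv : IntegrableOn v (Icc a b)) :
    ContinuousOn (fun x => ∫ θ in a..x, v θ) (Icc a b) := by
  have := intervalIntegral.continuousOn_primitive_interval (μ := volume) (a := a) (b := b) (f := v)
    (by rwa [uIcc_of_le hab])
  rwa [uIcc_of_le hab] at this

lemma intOp_ker0_eq {v : ℝ → E n} (hv : IntegrableOn v (Icc a b)) {x : ℝ} (hx : x ∈ Icc a b) :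
    intOp a b (ker0 a b B) v x
      = affCoeff a b B v 0 + ∫ y in a..x, intOp a b (ker1 a b B) v y := by
  have h1 : ∫ y in a..x, intOp a b (ker1 a b B) v y
      = ∫ y in a..x, (affCoeff a b B v 1 + ∫ θ in a..y, v θ) := by
    refine intervalIntegral.integral_congr fun y hy => ?_
    rw [uIcc_of_le hx.1] at hy
    exact intOp_ker1_eq hv ⟨hy.1, hy.2.trans hx.2⟩
  have h2 : IntervalIntegrable (fun y => ∫ θ in a..y, v θ) volume a x := by
    refine ContinuousOn.intervalIntegrable ?_
    rw [uIcc_of_le hx.1]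
    exact continuousOn_primitive hx.1 (hv.mono_set (Icc_subset_Icc le_rfl hx.2))
  rw [intOp_ker0_eq_affine hv hx, h1, intervalIntegral.integral_add (by simp) h2,
    intervalIntegral.integral_const, integral_sub_smul_eq hv hx, add_assoc]

lemma continuousOn_intOp_ker1 {v : ℝ → E n} (hab : a ≤ b) (hv : IntegrableOn v (Icc a b)) :
    ContinuousOn (intOp a b (ker1 a b B) v) (Icc a b) :=
  (continuousOn_const.add (continuousOn_primitive hab hv)).congr fun _ hx => intOp_ker1_eq hv hx

lemma continuousOn_intOp_ker0 {v : ℝ → E n} (hab : a ≤ b) (hv : IntegrableOn v (Icc a b)) :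
    ContinuousOn (intOp a b (ker0 a b B) v) (Icc a b) :=
  (continuousOn_const.add (continuousOn_primitive hab
    (continuousOn_intOp_ker1 hab hv).integrableOn_Icc)).congr fun _ hx => intOp_ker0_eq hv hx

lemma mulVec_boundary_intOp (hB : IsUnit (B * Hmat n a b)) (hab : a ≤ b) {v : ℝ → E n}
    (hv : IntegrableOn v (Icc a b)) :
    B *ᵥ stack ![intOp a b (ker0 a b B) v a, intOp a b (ker1 a b B) v a,
      intOp a b (ker0 a b B) v b, intOp a b (ker1 a b B) v b] = 0 := by
  have ha : a ∈ Icc a b := ⟨le_rfl, hab⟩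
  have hb : b ∈ Icc a b := ⟨hab, le_rfl⟩
  rw [intOp_ker0_eq_affine hv ha, intOp_ker0_eq_affine hv hb, intOp_ker1_eq hv ha,
    intOp_ker1_eq hv hb, intervalIntegral.integral_same, intervalIntegral.integral_same, sub_self,
    zero_smul, add_zero, add_zero, add_zero, intervalIntegral.integral_of_le hab,
    intervalIntegral.integral_of_le hab, ← integral_Icc_eq_integral_Ioc,
    ← integral_Icc_eq_integral_Ioc]
  exact mulVec_boundary_eq_zero hB v

end IntOp

/-! ### Bounded operators between the `L₂` spaces -/

section Operators

variable {n : ℕ} {a b : ℝ}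

lemma ae_mem_Icc_prod (a b c d : ℝ) :
    ∀ᵐ q ∂((volume.restrict (Icc a b)).prod (volume.restrict (Icc c d))),
      q.1 ∈ Icc a b ∧ q.2 ∈ Icc c d := by
  rw [Measure.prod_restrict]
  exact ae_restrict_mem (measurableSet_Icc.prod measurableSet_Icc)

lemma ae_box_mem : ∀ᵐ p ∂((volume : Measure (ℝ × ℝ)).restrict (box a b)),
    p.1 ∈ Icc (0 : ℝ) 1 ∧ p.2 ∈ Icc a b :=
  ae_restrict_mem (measurableSet_Icc.prod measurableSet_Icc)

lemma exists_intOp_clm {κ : ℝ × ℝ → E n →L[ℝ] E n} (hκ : IsBddKer a b κ) :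
    ∃ T : L2 n (Icc a b) →L[ℝ] L2 n (Icc a b),
      ∀ v, T v =ᵐ[volume.restrict (Icc a b)] intOp a b κ v := by
  obtain ⟨hm, C, hC⟩ := hκ
  obtain ⟨T, hT, -⟩ := exists_kerOp_clm (ν := volume.restrict (Icc a b))
    (ρ := volume.restrict (Icc a b)) (μ := volume.restrict (Icc a b)) (K := κ) (g := Prod.snd)
    (c := volume.restrict (Icc a b) univ) (C := C) hm.aestronglyMeasurable
    ((ae_mem_Icc_prod a b a b).mono fun q hq => hC _ hq.1 _ hq.2) measurable_snd
    (measure_ne_top _ _) Measure.map_snd_prod.le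
  exact ⟨T, hT⟩

lemma exists_intOp_box_clm {κ : ℝ × ℝ → E n →L[ℝ] E n} (hκ : IsBddKer a b κ) :
    ∃ T : L2 n (box a b) →L[ℝ] L2 n (box a b),
      ∀ ψ, T ψ =ᵐ[volume.restrict (box a b)] fun p => intOp a b κ (fun y => ψ (p.1, y)) p.2 := by
  obtain ⟨hm, C, hC⟩ := hκ
  obtain ⟨T, hT, -⟩ := exists_kerOp_clm (ν := volume.restrict (box a b))
    (ρ := volume.restrict (box a b)) (μ := volume.restrict (Icc a b))
    (K := fun q : (ℝ × ℝ) × ℝ => κ (q.1.2, q.2)) (g := fun q => (q.1.1, q.2))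
    (c := volume.restrict (Icc a b) univ) (C := C)
    (hm.comp_measurable (by fun_prop)).aestronglyMeasurable
    (by
      have h1 := (Measure.quasiMeasurePreserving_fst (μ := volume.restrict (box a b))
        (ν := volume.restrict (Icc a b))).ae (ae_box_mem (a := a) (b := b))
      have h2 := (Measure.quasiMeasurePreserving_snd (μ := volume.restrict (box a b))
        (ν := volume.restrict (Icc a b))).ae (ae_restrict_mem measurableSet_Icc)
      filter_upwards [h1, h2] with q hq hq'
      exact hC _ hq.2 _ hq')
    (by fun_prop) (measure_ne_top _ _)
    (by
      rw [volume_restrict_box]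
      refine le_of_eq ?_
      refine (Measure.map_prod_map _ _ measurable_fst measurable_id).symm.trans ?_
      rw [Measure.map_fst_prod, Measure.map_id, Measure.prod_smul_left])
  exact ⟨T, hT⟩

lemma exists_ext_clm (n : ℕ) (a b : ℝ) : ∃ T : L2 n (Icc a b) →L[ℝ] L2 n (box a b),
    ∀ v, T v =ᵐ[volume.restrict (box a b)] fun p => v p.2 := by
  obtain ⟨T, hT, -⟩ := exists_kerOp_clm (F := E n) (ν := volume.restrict (Icc a b))
    (ρ := volume.restrict (box a b)) (μ := volume.restrict (Icc (0 : ℝ) 1))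
    (K := fun _ : (ℝ × ℝ) × ℝ => ContinuousLinearMap.id ℝ (E n)) (g := fun q => q.1.2)
    (c := 1) (C := 1)
    aestronglyMeasurable_const (Eventually.of_forall fun _ => ContinuousLinearMap.norm_id_le)
    (by fun_prop) (by simp)
    (by
      have : (fun q : (ℝ × ℝ) × ℝ => q.1.2) = Prod.snd ∘ Prod.fst := rfl
      rw [volume_restrict_box, this, ← Measure.map_map measurable_snd measurable_fst,
        Measure.map_fst_prod, Measure.map_smul, Measure.map_snd_prod]
      simp)
  refine ⟨T, fun v => (hT v).trans (Eventually.of_forall fun p => ?_)⟩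
  simp [kerOp]

lemma exists_primitive_box_clm (n : ℕ) (a b : ℝ) : ∃ T : L2 n (box a b) →L[ℝ] L2 n (box a b),
    ∀ ψ, T ψ =ᵐ[volume.restrict (box a b)] fun p => ∫ θ in (0 : ℝ)..p.1, ψ (θ, p.2) := by
  obtain ⟨T, hT, -⟩ := exists_kerOp_clm (F := E n) (ν := volume.restrict (box a b))
    (ρ := volume.restrict (box a b)) (μ := volume.restrict (Icc (0 : ℝ) 1))
    (K := fun q : (ℝ × ℝ) × ℝ => if q.2 ≤ q.1.1 then ContinuousLinearMap.id ℝ (E n) else 0)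
    (g := fun q => (q.2, q.1.2)) (c := 1) (C := 1)
    (by
      exact (StronglyMeasurable.ite (measurableSet_le measurable_snd measurable_fst.fst)
        stronglyMeasurable_const stronglyMeasurable_const).aestronglyMeasurable)
    (Eventually.of_forall fun q => by
      split_ifs
      · exact ContinuousLinearMap.norm_id_le
      · simp)
    (by fun_prop) (by simp)
    (by
      have : (fun q : (ℝ × ℝ) × ℝ => (q.2, q.1.2)) = Prod.swap ∘ Prod.map Prod.snd id := rfl
      rw [volume_restrict_box, this, ← Measure.map_map measurable_swap (by fun_prop),
        ← Measure.map_prod_map _ _ measurable_snd measurable_id, Measure.prod_swap,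
        Measure.map_snd_prod, Measure.map_id]
      simp)
  refine ⟨T, fun ψ => (hT ψ).trans ?_⟩
  filter_upwards [ae_box_mem] with p hp
  rw [intervalIntegral_left_eq_setIntegral_ite hp.1]
  refine integral_congr_ae (Eventually.of_forall fun θ => ?_)
  dsimp only
  split_ifs <;> rfl

lemma exists_average_clm (n : ℕ) (a b : ℝ) {r s : ℝ} (hr : 0 ≤ r) (hrs : r ≤ s) (hs : s ≤ 1) :
    ∃ T : L2 n (box a b) →L[ℝ] L2 n (Icc a b),
      (∀ ψ, T ψ =ᵐ[volume.restrict (Icc a b)] fun x => ∫ θ in r..s, ψ (θ, x)) ∧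
      ∀ ψ, ‖T ψ‖ ≤ √(s - r) * ‖ψ‖ := by
  obtain ⟨T, hT, hT'⟩ := exists_kerOp_clm (F := E n) (ν := volume.restrict (box a b))
    (ρ := volume.restrict (Icc a b)) (μ := volume.restrict (Ioc r s))
    (K := fun _ : ℝ × ℝ => ContinuousLinearMap.id ℝ (E n)) (g := Prod.swap)
    (c := 1) (C := 1)
    aestronglyMeasurable_const (Eventually.of_forall fun _ => ContinuousLinearMap.norm_id_le)
    measurable_swap (by simp)
    (by
      rw [Measure.prod_swap, one_smul, Measure.prod_restrict, box, ← Measure.volume_eq_prod]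
      have hsub : Ioc r s ⊆ Icc (0 : ℝ) 1 := fun x hx => ⟨hr.trans hx.1.le, hx.2.trans hs⟩
      exact Measure.restrict_mono (Set.prod_mono hsub Subset.rfl) le_rfl)
  · refine ⟨T, fun ψ => (hT ψ).trans (Eventually.of_forall fun x => ?_), fun ψ => ?_⟩
    · dsimp only
      rw [intervalIntegral.integral_of_le hrs]
      rfl
    · refine (hT' ψ).trans (le_of_eq ?_)
      congr 1
      simp [Real.sqrt_eq_rpow, ← ENNReal.toReal_rpow, ENNReal.toReal_ofReal (sub_nonneg.mpr hrs)]

end Operators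

/-! ### Slices, primitives in `s`, and traces -/

section Slices

variable {n : ℕ} {a b : ℝ}

lemma ae_box_of_ae_snd {p : ℝ → Prop} (h : ∀ᵐ x ∂(volume.restrict (Icc a b)), p x) :
    ∀ᵐ q ∂((volume : Measure (ℝ × ℝ)).restrict (box a b)), p q.2 := by
  rw [volume_restrict_box]
  exact Measure.quasiMeasurePreserving_snd.ae h

lemma ae_box_of_ae_fst {p : ℝ → Prop} (h : ∀ᵐ s ∂(volume.restrict (Icc (0 : ℝ) 1)), p s) :
    ∀ᵐ q ∂((volume : Measure (ℝ × ℝ)).restrict (box a b)), p q.1 := by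
  rw [volume_restrict_box]
  exact Measure.quasiMeasurePreserving_fst.ae h

lemma ae_slice_left {p : ℝ × ℝ → Prop}
    (h : ∀ᵐ q ∂((volume : Measure (ℝ × ℝ)).restrict (box a b)), p q) :
    ∀ᵐ s ∂(volume.restrict (Icc (0 : ℝ) 1)), ∀ᵐ x ∂(volume.restrict (Icc a b)), p (s, x) := by
  rw [volume_restrict_box] at h
  exact Measure.ae_ae_of_ae_prod h

lemma ae_slice_right {p : ℝ × ℝ → Prop}
    (h : ∀ᵐ q ∂((volume : Measure (ℝ × ℝ)).restrict (box a b)), p q) :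
    ∀ᵐ x ∂(volume.restrict (Icc a b)), ∀ᵐ s ∂(volume.restrict (Icc (0 : ℝ) 1)), p (s, x) := by
  rw [volume_restrict_box, ← Measure.prod_swap] at h
  exact Measure.ae_ae_of_ae_prod (ae_of_ae_map measurable_swap.aemeasurable h)

lemma intervalIntegral_congr_ae_Icc {c d s : ℝ} (hs : s ∈ Icc c d) {f g : ℝ → E n}
    (h : f =ᵐ[volume.restrict (Icc c d)] g) : ∫ θ in c..s, f θ = ∫ θ in c..s, g θ := by
  rw [intervalIntegral.integral_of_le hs.1, intervalIntegral.integral_of_le hs.1]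
  have hsub : Ioc c s ⊆ Icc c d := fun x hx => ⟨hx.1.le, hx.2.trans hs.2⟩
  exact integral_congr_ae (ae_restrict_of_ae_restrict_of_subset hsub h)

lemma intOp_congr_ae {κ : ℝ × ℝ → E n →L[ℝ] E n} {v w : ℝ → E n}
    (h : v =ᵐ[volume.restrict (Icc a b)] w) (x : ℝ) : intOp a b κ v x = intOp a b κ w x :=
  integral_congr_ae (h.mono fun θ hθ => by dsimp only; rw [hθ])

/-- The bounded operator on `L₂[a,b]` with kernel `κ`. -/
def intCLM {κ : ℝ × ℝ → E n →L[ℝ] E n} (hκ : IsBddKer a b κ) :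
    L2 n (Icc a b) →L[ℝ] L2 n (Icc a b) := (exists_intOp_clm hκ).choose

lemma intCLM_ae {κ : ℝ × ℝ → E n →L[ℝ] E n} (hκ : IsBddKer a b κ) (v : L2 n (Icc a b)) :
    intCLM hκ v =ᵐ[volume.restrict (Icc a b)] intOp a b κ v :=
  (exists_intOp_clm hκ).choose_spec v

/-- The bounded operator on `L₂([0,1] × [a,b])` with kernel `κ` in the variable `x`. -/
def boxCLM {κ : ℝ × ℝ → E n →L[ℝ] E n} (hκ : IsBddKer a b κ) :
    L2 n (box a b) →L[ℝ] L2 n (box a b) := (exists_intOp_box_clm hκ).choose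

lemma boxCLM_ae {κ : ℝ × ℝ → E n →L[ℝ] E n} (hκ : IsBddKer a b κ) (ψ : L2 n (box a b)) :
    boxCLM hκ ψ =ᵐ[volume.restrict (box a b)]
      fun p => intOp a b κ (fun y => ψ (p.1, y)) p.2 :=
  (exists_intOp_box_clm hκ).choose_spec ψ

/-- The extension of a function of `x` that is constant in `s`. -/
def extCLM (n : ℕ) (a b : ℝ) : L2 n (Icc a b) →L[ℝ] L2 n (box a b) := (exists_ext_clm n a b).choose

lemma extCLM_ae (v : L2 n (Icc a b)) :
    extCLM n a b v =ᵐ[volume.restrict (box a b)] fun p => v p.2 :=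
  (exists_ext_clm n a b).choose_spec v

/-- The primitive `∫₀ˢ ψ(θ,x) dθ`. -/
def primCLM (n : ℕ) (a b : ℝ) : L2 n (box a b) →L[ℝ] L2 n (box a b) :=
  (exists_primitive_box_clm n a b).choose

lemma primCLM_ae (ψ : L2 n (box a b)) :
    primCLM n a b ψ =ᵐ[volume.restrict (box a b)] fun p => ∫ θ in (0 : ℝ)..p.1, ψ (θ, p.2) :=
  (exists_primitive_box_clm n a b).choose_spec ψ

lemma primCLM_ae_of_ae {ψ : L2 n (box a b)} {h : ℝ × ℝ → E n}
    (hψ : ψ =ᵐ[volume.restrict (box a b)] h) :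
    primCLM n a b ψ =ᵐ[volume.restrict (box a b)] fun p => ∫ θ in (0 : ℝ)..p.1, h (θ, p.2) := by
  filter_upwards [primCLM_ae ψ, ae_box_mem, ae_box_of_ae_snd (ae_slice_right hψ)] with p hp hm hx
  rw [hp]
  exact intervalIntegral_congr_ae_Icc hm.1 hx

/-- The function `∫₀ʳ ψ(θ,·) dθ` of `x`, for a fixed `r ∈ [0,1]`. -/
def avgCLM (n : ℕ) (a b r : ℝ) : L2 n (box a b) →L[ℝ] L2 n (Icc a b) :=
  open Classical in
  if h : r ∈ Icc (0 : ℝ) 1 then (exists_average_clm n a b le_rfl h.1 h.2).choose else 0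

lemma avgCLM_ae {r : ℝ} (hr : r ∈ Icc (0 : ℝ) 1) (ψ : L2 n (box a b)) :
    avgCLM n a b r ψ =ᵐ[volume.restrict (Icc a b)] fun x => ∫ θ in (0 : ℝ)..r, ψ (θ, x) := by
  rw [avgCLM, dif_pos hr]
  exact (exists_average_clm n a b le_rfl hr.1 hr.2).choose_spec.1 ψ

lemma avgCLM_zero (ψ : L2 n (box a b)) : avgCLM n a b 0 ψ = 0 := by
  rw [Lp.eq_zero_iff_ae_eq_zero]
  filter_upwards [avgCLM_ae (r := 0) (by simp) ψ] with x hx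
  rw [hx, intervalIntegral.integral_same]
  rfl

lemma norm_avgCLM_sub_le_of_le {r s : ℝ} (hr : r ∈ Icc (0 : ℝ) 1) (hs : s ∈ Icc (0 : ℝ) 1)
    (hrs : r ≤ s) (ψ : L2 n (box a b)) :
    ‖avgCLM n a b s ψ - avgCLM n a b r ψ‖ ≤ √(s - r) * ‖ψ‖ := by
  obtain ⟨T, hT, hT'⟩ := exists_average_clm n a b hr.1 hrs hs.2
  have : avgCLM n a b s ψ - avgCLM n a b r ψ = T ψ := by
    refine Lp.ext ?_
    filter_upwards [Lp.coeFn_sub (avgCLM n a b s ψ) (avgCLM n a b r ψ), avgCLM_ae hr ψ,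
      avgCLM_ae hs ψ, hT ψ, (integrable_L2_box ψ).prod_left_ae] with x h1 h2 h3 h4 h5
    rw [h1, Pi.sub_apply, h2, h3, h4]
    have hi : ∀ u ∈ Icc (0 : ℝ) 1, IntervalIntegrable (fun θ => ψ (θ, x)) volume 0 u := by
      intro u hu
      rw [intervalIntegrable_iff_integrableOn_Icc_of_le hu.1]
      exact IntegrableOn.mono_set h5 (Icc_subset_Icc le_rfl hu.2)
    exact intervalIntegral.integral_interval_sub_left (hi s hs) (hi r hr)
  rw [this]
  exact hT' ψ

lemma norm_avgCLM_sub_le {r s : ℝ} (hr : r ∈ Icc (0 : ℝ) 1) (hs : s ∈ Icc (0 : ℝ) 1)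
    (ψ : L2 n (box a b)) : ‖avgCLM n a b s ψ - avgCLM n a b r ψ‖ ≤ √|s - r| * ‖ψ‖ := by
  rcases le_total r s with h | h
  · rw [abs_of_nonneg (sub_nonneg.mpr h)]
    exact norm_avgCLM_sub_le_of_le hr hs h ψ
  · rw [norm_sub_rev, abs_sub_comm, abs_of_nonneg (sub_nonneg.mpr h)]
    exact norm_avgCLM_sub_le_of_le hs hr h ψ

lemma continuousOn_avgCLM (ψ : L2 n (box a b)) :
    ContinuousOn (fun r => avgCLM n a b r ψ) (Icc 0 1) := by
  intro r hr
  rw [ContinuousWithinAt, tendsto_iff_norm_sub_tendsto_zero]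
  have h0 : Tendsto (fun s : ℝ => √|s - r| * ‖ψ‖) (𝓝[Icc 0 1] r) (𝓝 0) := by
    have hc : Continuous fun s : ℝ => √|s - r| * ‖ψ‖ := by fun_prop
    have := (hc.tendsto r).mono_left (nhdsWithin_le_nhds (s := Icc (0 : ℝ) 1))
    simpa using this
  refine squeeze_zero' (Eventually.of_forall fun _ => norm_nonneg _) ?_ h0
  filter_upwards [self_mem_nhdsWithin] with s hs
  exact norm_avgCLM_sub_le hr hs ψ

lemma integrable_intOp_slices {κ : ℝ × ℝ → E n →L[ℝ] E n} (hκ : IsBddKer a b κ)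
    (ψ : L2 n (box a b)) {x : ℝ} (hx : x ∈ Icc a b) :
    Integrable (fun q : ℝ × ℝ => κ (x, q.2) (ψ q))
      ((volume.restrict (Icc (0 : ℝ) 1)).prod (volume.restrict (Icc a b))) := by
  obtain ⟨hm, C, hC⟩ := hκ
  have hψ := integrable_L2_box ψ
  refine (hψ.norm.const_mul C).mono' ?_ ?_
  · exact (ContinuousLinearMap.id ℝ (E n →L[ℝ] E n)).aestronglyMeasurable_comp₂
      (hm.comp_measurable (measurable_const.prodMk measurable_snd)).aestronglyMeasurable hψ.1
  · filter_upwards [ae_mem_Icc_prod 0 1 a b] with q hq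
    exact (κ (x, q.2)).le_of_opNorm_le (hC x hx _ hq.2) _

/-- Integration in `s` commutes with an integral operator in `x`. -/
lemma intOp_integral_slices {κ : ℝ × ℝ → E n →L[ℝ] E n} (hκ : IsBddKer a b κ)
    (ψ : L2 n (box a b)) {x : ℝ} (hx : x ∈ Icc a b) {r : ℝ} (hr : r ∈ Icc (0 : ℝ) 1) :
    intOp a b κ (fun y => ∫ θ in (0 : ℝ)..r, ψ (θ, y)) x
      = ∫ θ in (0 : ℝ)..r, intOp a b κ (fun y => ψ (θ, y)) x := by
  have hsub : Ioc 0 r ⊆ Icc (0 : ℝ) 1 := fun y hy => ⟨hy.1.le, hy.2.trans hr.2⟩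
  have hint : Integrable (Function.uncurry fun θ y : ℝ => κ (x, y) (ψ (θ, y)))
      ((volume.restrict (Ioc (0 : ℝ) r)).prod (volume.restrict (Icc a b))) := by
    refine (integrable_intOp_slices hκ ψ hx).mono_measure ?_
    rw [Measure.prod_restrict, Measure.prod_restrict]
    exact Measure.restrict_mono (Set.prod_mono hsub Subset.rfl) le_rfl
  simp only [intOp, intervalIntegral.integral_of_le hr.1]
  rw [integral_integral_swap hint]
  refine integral_congr_ae ?_
  filter_upwards [(integrable_L2_box ψ).prod_left_ae] with y hy
  exact ((κ (x, y)).integral_comp_comm (IntegrableOn.mono_set hy hsub)).symm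

lemma primCLM_boxCLM_slice {κ : ℝ × ℝ → E n →L[ℝ] E n} (hκ : IsBddKer a b κ)
    (ψ : L2 n (box a b)) : ∀ᵐ r ∂(volume.restrict (Icc (0 : ℝ) 1)),
      intCLM hκ (avgCLM n a b r ψ) =ᵐ[volume.restrict (Icc a b)]
        fun x => primCLM n a b (boxCLM hκ ψ) (r, x) := by
  filter_upwards [ae_slice_left (primCLM_ae_of_ae (boxCLM_ae hκ ψ)),
    ae_restrict_mem measurableSet_Icc] with r h1 hr
  filter_upwards [h1, intCLM_ae hκ (avgCLM n a b r ψ), ae_restrict_mem measurableSet_Icc]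
    with x h2 h3 hx
  rw [h2, h3, intOp_congr_ae (avgCLM_ae hr ψ), intOp_integral_slices hκ ψ hx hr]

lemma primCLM_slice (ψ : L2 n (box a b)) : ∀ᵐ r ∂(volume.restrict (Icc (0 : ℝ) 1)),
    avgCLM n a b r ψ =ᵐ[volume.restrict (Icc a b)] fun x => primCLM n a b ψ (r, x) := by
  filter_upwards [ae_slice_left (primCLM_ae ψ), ae_restrict_mem measurableSet_Icc] with r h1 hr
  filter_upwards [h1, avgCLM_ae hr ψ] with x h2 h3
  rw [h2, h3]

lemma isWeakDeriv_ext_add_prim (v : L2 n (Icc a b)) (ψ : L2 n (box a b)) :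
    IsWeakDeriv ((1 : ℝ), (0 : ℝ)) (extCLM n a b v + primCLM n a b ψ) ψ := by
  refine isWeakDeriv_fst_of_primitive ?_
  filter_upwards [ae_slice_right (Lp.coeFn_add (extCLM n a b v) (primCLM n a b ψ)),
    ae_slice_right (extCLM_ae v), ae_slice_right (primCLM_ae ψ)] with x h1 h2 h3
  refine ⟨v x, ?_⟩
  filter_upwards [h1, h2, h3] with s h1 h2 h3
  rw [h1, Pi.add_apply, h2, h3]

end Slices

/-! ### The map from `Z` onto the domain of the delayed PDE -/

section Solve

variable {n : ℕ} {a b : ℝ}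

/-- `v ↦ ∂ₓʲ𝒯₁v`. -/
def opG (a b : ℝ) (B : Matrix (Fin 2 × Fin n) (Fin 4 × Fin n) ℝ) :
    Fin 3 → L2 n (Icc a b) →L[ℝ] L2 n (Icc a b) :=
  ![intCLM (isBddKer_ker0 (B := B)), intCLM (isBddKer_ker1 (B := B)), ContinuousLinearMap.id ℝ _]

/-- `ψ ↦ ∂ₓʲ𝒯₁ψ(s)`. -/
def opGbox (a b : ℝ) (B : Matrix (Fin 2 × Fin n) (Fin 4 × Fin n) ℝ) :
    Fin 3 → L2 n (box a b) →L[ℝ] L2 n (box a b) :=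
  ![boxCLM (isBddKer_ker0 (B := B)), boxCLM (isBddKer_ker1 (B := B)), ContinuousLinearMap.id ℝ _]

variable {B : Matrix (Fin 2 × Fin n) (Fin 4 × Fin n) ℝ}

lemma opG_zero_ae (v : L2 n (Icc a b)) :
    opG a b B 0 v =ᵐ[volume.restrict (Icc a b)] intOp a b (ker0 a b B) v :=
  intCLM_ae isBddKer_ker0 v

lemma opG_one_ae (v : L2 n (Icc a b)) :
    opG a b B 1 v =ᵐ[volume.restrict (Icc a b)] intOp a b (ker1 a b B) v :=
  intCLM_ae isBddKer_ker1 v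

lemma opGbox_zero_ae (ψ : L2 n (box a b)) : opGbox a b B 0 ψ =ᵐ[volume.restrict (box a b)]
    fun p => intOp a b (ker0 a b B) (fun y => ψ (p.1, y)) p.2 :=
  boxCLM_ae isBddKer_ker0 ψ

lemma opGbox_one_ae (ψ : L2 n (box a b)) : opGbox a b B 1 ψ =ᵐ[volume.restrict (box a b)]
    fun p => intOp a b (ker1 a b B) (fun y => ψ (p.1, y)) p.2 :=
  boxCLM_ae isBddKer_ker1 ψ

lemma opG_succ_primitive (v : L2 n (Icc a b)) (j : Fin 2) :
    ∃ c : E n, ∀ᵐ x ∂(volume.restrict (Icc a b)),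
      opG a b B j.castSucc v x = c + ∫ θ in a..x, opG a b B j.succ v θ := by
  have hv := integrable_L2_Icc v
  fin_cases j
  · refine ⟨affCoeff a b B v 0, ?_⟩
    filter_upwards [opG_zero_ae (B := B) v, ae_restrict_mem measurableSet_Icc] with x h1 hx
    refine h1.trans ?_
    rw [intOp_ker0_eq hv hx]
    congr 1
    exact (intervalIntegral_congr_ae_Icc hx (opG_one_ae v)).symm
  · refine ⟨affCoeff a b B v 1, ?_⟩
    filter_upwards [opG_one_ae (B := B) v, ae_restrict_mem measurableSet_Icc] with x h1 hx
    refine h1.trans ?_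
    rw [intOp_ker1_eq hv hx]
    rfl

lemma opGbox_succ_primitive (ψ : L2 n (box a b)) (j : Fin 2) :
    ∀ᵐ s ∂(volume.restrict (Icc (0 : ℝ) 1)), ∃ c : E n, ∀ᵐ x ∂(volume.restrict (Icc a b)),
      opGbox a b B j.castSucc ψ (s, x) = c + ∫ θ in a..x, opGbox a b B j.succ ψ (s, θ) := by
  filter_upwards [ae_slice_left (opGbox_zero_ae (B := B) ψ), ae_slice_left (opGbox_one_ae (B := B) ψ),
    (integrable_L2_box ψ).prod_right_ae] with s h0 h1 hv
  fin_cases j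
  · refine ⟨affCoeff a b B (fun y => ψ (s, y)) 0, ?_⟩
    filter_upwards [h0, ae_restrict_mem measurableSet_Icc] with x h hx
    refine h.trans ?_
    rw [intOp_ker0_eq hv hx]
    congr 1
    exact (intervalIntegral_congr_ae_Icc hx h1).symm
  · refine ⟨affCoeff a b B (fun y => ψ (s, y)) 1, ?_⟩
    filter_upwards [h1, ae_restrict_mem measurableSet_Icc] with x h hx
    refine h.trans ?_
    rw [intOp_ker1_eq hv hx]
    rfl

/-- The derivative `∂ₓʲφ` of the second component `φ` of `𝒯(v,ψ)`. -/
def opPhi (a b : ℝ) (B : Matrix (Fin 2 × Fin n) (Fin 4 × Fin n) ℝ) (j : Fin 3) :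
    Z n a b →L[ℝ] L2 n (box a b) :=
  (extCLM n a b ∘L opG a b B j) ∘L ContinuousLinearMap.fst ℝ _ _ +
    (primCLM n a b ∘L opGbox a b B j) ∘L ContinuousLinearMap.snd ℝ _ _

lemma opPhi_apply (j : Fin 3) (z : Z n a b) :
    opPhi a b B j z = extCLM n a b (opG a b B j z.1) + primCLM n a b (opGbox a b B j z.2) := rfl

lemma opG_slice (j : Fin 3) (ψ : L2 n (box a b)) : ∀ᵐ r ∂(volume.restrict (Icc (0 : ℝ) 1)),
    opG a b B j (avgCLM n a b r ψ) =ᵐ[volume.restrict (Icc a b)]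
      fun x => primCLM n a b (opGbox a b B j ψ) (r, x) := by
  fin_cases j
  · exact primCLM_boxCLM_slice isBddKer_ker0 ψ
  · exact primCLM_boxCLM_slice isBddKer_ker1 ψ
  · exact primCLM_slice ψ

lemma opPhi_slice (j : Fin 3) (z : Z n a b) : ∀ᵐ r ∂(volume.restrict (Icc (0 : ℝ) 1)),
    opG a b B j (z.1 + avgCLM n a b r z.2) =ᵐ[volume.restrict (Icc a b)]
      fun x => opPhi a b B j z (r, x) := by
  filter_upwards [opG_slice (B := B) j z.2, ae_slice_left (extCLM_ae (opG a b B j z.1)),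
    ae_slice_left (Lp.coeFn_add (extCLM n a b (opG a b B j z.1))
      (primCLM n a b (opGbox a b B j z.2)))] with r h1 h2 h3
  rw [map_add]
  filter_upwards [h1, h2, h3,
    Lp.coeFn_add (opG a b B j z.1) (opG a b B j (avgCLM n a b r z.2))] with x h1 h2 h3 h4
  rw [h4, Pi.add_apply, h1, opPhi_apply, h3, Pi.add_apply, h2]

lemma opPhi_succ_primitive (z : Z n a b) (j : Fin 2) :
    ∀ᵐ s ∂(volume.restrict (Icc (0 : ℝ) 1)), ∃ c : E n, ∀ᵐ x ∂(volume.restrict (Icc a b)),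
      opPhi a b B j.castSucc z (s, x) = c + ∫ θ in a..x, opPhi a b B j.succ z (s, θ) := by
  filter_upwards [opPhi_slice (B := B) j.castSucc z, opPhi_slice (B := B) j.succ z] with s h0 h1
  obtain ⟨c, hc⟩ := opG_succ_primitive (B := B) (z.1 + avgCLM n a b s z.2) j
  refine ⟨c, ?_⟩
  filter_upwards [h0, hc, ae_restrict_mem measurableSet_Icc] with x h2 h3 hx
  rw [← h2, h3, intervalIntegral_congr_ae_Icc hx h1]

variable (B) in
/-- `𝒯₁` as a bounded operator from `L₂` to `H₂`. -/
def solveH2 (hab : a ≤ b) : L2 n (Icc a b) →L[ℝ] H2 n a b :=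
  (ContinuousLinearMap.pi (opG a b B)).codRestrict (Sob1 n 2 a b) fun v i => by
    obtain ⟨c, hc⟩ := opG_succ_primitive (B := B) v i
    exact isWeakDeriv_of_primitive hab c hc

variable (B) in
/-- The second component of `𝒯` as a bounded operator from `Z` to `H_{(1,2)}`. -/
def solveH12 (hab : a ≤ b) : Z n a b →L[ℝ] H12 n a b :=
  (ContinuousLinearMap.pi ![ContinuousLinearMap.pi (opPhi a b B),
    ContinuousLinearMap.pi fun j => opGbox a b B j ∘L ContinuousLinearMap.snd ℝ _ _]).codRestrict
    (Sob2 n 1 2 a b) fun z => by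
      refine ⟨fun i j => ?_, fun i j => ?_⟩
      · fin_cases i
        exact isWeakDeriv_ext_add_prim (opG a b B j z.1) (opGbox a b B j z.2)
      · fin_cases i
        · exact isWeakDeriv_snd_of_primitive hab (opPhi_succ_primitive z j)
        · exact isWeakDeriv_snd_of_primitive hab (opGbox_succ_primitive z.2 j)

variable (B) in
/-- `𝒯` as a bounded operator from `Z` to `H₂ × H_{(1,2)}`. -/
def solve (hab : a ≤ b) : Z n a b →L[ℝ] H2 n a b × H12 n a b :=
  (solveH2 B hab ∘L ContinuousLinearMap.fst ℝ _ _).prod (solveH12 B hab)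

lemma fund_solve (hab : a ≤ b) (z : Z n a b) : fund (solve B hab z) = z := rfl

lemma solveH2_mem_XB (hB : IsUnit (B * Hmat n a b)) (hab : a ≤ b) (v : L2 n (Icc a b)) :
    solveH2 B hab v ∈ XB a b B :=
  ⟨intOp a b (ker0 a b B) v, intOp a b (ker1 a b B) v,
    continuousOn_intOp_ker0 hab (integrable_L2_Icc v),
    continuousOn_intOp_ker1 hab (integrable_L2_Icc v), opG_zero_ae v, opG_one_ae v,
    mulVec_boundary_intOp hB hab (integrable_L2_Icc v)⟩

lemma hasTrace_solveH12 (hab : a ≤ b) (z : Z n a b) (s : ℝ) :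
    HasTrace (solveH12 B hab z) s (solveH2 B hab (z.1 + avgCLM n a b s z.2)) := by
  refine ⟨fun s => solveH2 B hab (z.1 + avgCLM n a b s z.2), ?_, ?_, rfl⟩
  · exact (solveH2 B hab).continuous.comp_continuousOn
      (continuousOn_const.add (continuousOn_avgCLM z.2))
  · rw [ae_all_iff]
    exact fun j => opPhi_slice j z

lemma solve_mem_dom (hB : IsUnit (B * Hmat n a b)) (hab : a ≤ b) (z : Z n a b) :
    solve B hab z ∈ dom a b B := by
  refine ⟨solveH2_mem_XB hB hab z.1, ?_, fun s _ => ⟨_, solveH2_mem_XB hB hab _,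
    hasTrace_solveH12 hab z s⟩⟩
  have := hasTrace_solveH12 (B := B) hab z 0
  rwa [avgCLM_zero, add_zero] at this

lemma sobFun_solve (hab : a ≤ b) (z : Z n a b) :
    EqAE a b (sobFun (solve B hab z)) (opT a b B z.toFun) := by
  have hv := integrable_L2_Icc z.1
  have h1 : opG a b B 0 z.1 =ᵐ[volume.restrict (Icc a b)] opT1 a b B z.1 := by
    filter_upwards [opG_zero_ae (B := B) z.1, ae_restrict_mem measurableSet_Icc] with x h hx
    rw [h, opT1_eq_intOp hv hx]
  refine ⟨h1, ?_⟩
  have h2 : opGbox a b B 0 z.2 =ᵐ[volume.restrict (box a b)]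
      fun p => intOp a b (ker0 a b B) (fun y => z.2 (p.1, y)) p.2 := opGbox_zero_ae z.2
  change opPhi a b B 0 z =ᵐ[_] _
  rw [opPhi_apply]
  filter_upwards [Lp.coeFn_add (extCLM n a b (opG a b B 0 z.1)) (primCLM n a b (opGbox a b B 0 z.2)),
    extCLM_ae (opG a b B 0 z.1), primCLM_ae_of_ae h2, ae_box_of_ae_snd h1, ae_box_mem]
    with p h3 h4 h5 h6 hp
  rw [h3, Pi.add_apply, h4, h5, h6]
  change _ = opT1 a b B z.1 p.2 + ∫ θ in (0 : ℝ)..p.1, opT1 a b B (fun y => z.2 (θ, y)) p.2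
  congr 1
  refine intervalIntegral_congr_ae_Icc hp.1 ?_
  filter_upwards [(integrable_L2_box z.2).prod_right_ae] with θ hθ
  rw [opT1_eq_intOp hθ hp.2]

lemma opGbox_zero_ae_opT1 (ψ : L2 n (box a b)) : opGbox a b B 0 ψ =ᵐ[volume.restrict (box a b)]
    fun p => opT1 a b B (fun y => ψ (p.1, y)) p.2 := by
  have h := ae_box_of_ae_fst (a := a) (b := b) (integrable_L2_box ψ).prod_right_ae
  filter_upwards [opGbox_zero_ae (B := B) ψ, h, ae_box_mem] with p h1 h2 hp
  rw [h1, opT1_eq_intOp h2 hp.2]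

end Solve

/-! ### Uniqueness -/

section Uniqueness

variable {n : ℕ} {a b : ℝ} {B : Matrix (Fin 2 × Fin n) (Fin 4 × Fin n) ℝ}

lemma H2_eq_zero {u : H2 n a b} (h : u.1 0 = 0) : u = 0 := by
  have h1 : u.1 1 = 0 := by
    have h' : IsWeakDeriv (1 : ℝ) (u.1 0) (u.1 1) := u.2 0
    rw [h] at h'
    exact h'.eq_zero volume_frontier_Icc
  have h2 : u.1 2 = 0 := by
    have h' : IsWeakDeriv (1 : ℝ) (u.1 1) (u.1 2) := u.2 1
    rw [h1] at h'
    exact h'.eq_zero volume_frontier_Icc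
  refine Subtype.ext (funext fun j => ?_)
  fin_cases j
  · exact h
  · exact h1
  · exact h2

lemma H12_eq_zero {φ : H12 n a b} (h : φ.1 0 0 = 0) : φ = 0 := by
  have h1 : φ.1 0 1 = 0 := by
    have h' : IsWeakDeriv ((0 : ℝ), (1 : ℝ)) (φ.1 0 0) (φ.1 0 1) := φ.2.2 0 0
    rw [h] at h'
    exact h'.eq_zero volume_frontier_box
  have h2 : φ.1 0 2 = 0 := by
    have h' : IsWeakDeriv ((0 : ℝ), (1 : ℝ)) (φ.1 0 1) (φ.1 0 2) := φ.2.2 0 1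
    rw [h1] at h'
    exact h'.eq_zero volume_frontier_box
  have h0 : ∀ j, φ.1 0 j = 0 := by
    intro j
    fin_cases j
    · exact h
    · exact h1
    · exact h2
  refine Subtype.ext (funext fun i => funext fun j => ?_)
  fin_cases i
  · exact h0 j
  · have h' : IsWeakDeriv ((1 : ℝ), (0 : ℝ)) (φ.1 0 j) (φ.1 1 j) := φ.2.1 0 j
    rw [h0 j] at h'
    exact h'.eq_zero volume_frontier_box

/-- An element of `H₂ × H_{(1,2)}` is determined by its underlying pair of functions. -/
lemma eq_of_sobFun_ae {w w' : H2 n a b × H12 n a b} (h : EqAE a b (sobFun w) (sobFun w')) :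
    w = w' := by
  refine Prod.ext (sub_eq_zero.mp (H2_eq_zero ?_)) (sub_eq_zero.mp (H12_eq_zero ?_))
  · exact sub_eq_zero.mpr (Lp.ext h.1)
  · exact sub_eq_zero.mpr (Lp.ext h.2)

/-- The representative of `φ` that is continuous from `[0,1]` to `H₂` is unique. -/
lemma eqOn_of_traces {φ : H12 n a b} {S S' : ℝ → H2 n a b}
    (hS : ContinuousOn S (Icc 0 1)) (hS' : ContinuousOn S' (Icc 0 1))
    (h : ∀ᵐ r ∂(volume.restrict (Icc (0 : ℝ) 1)), ∀ j : Fin 3,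
      (S r).1 j =ᵐ[volume.restrict (Icc a b)] fun x => φ.1 0 j (r, x))
    (h' : ∀ᵐ r ∂(volume.restrict (Icc (0 : ℝ) 1)), ∀ j : Fin 3,
      (S' r).1 j =ᵐ[volume.restrict (Icc a b)] fun x => φ.1 0 j (r, x)) :
    EqOn S S' (Icc 0 1) := by
  refine Measure.eqOn_Icc_of_ae_eq volume zero_ne_one ?_ hS hS'
  filter_upwards [h, h'] with r hr hr'
  exact Subtype.ext (funext fun j => Lp.ext ((hr j).trans (hr' j).symm))

lemma HasTrace.unique {φ : H12 n a b} {s : ℝ} (hs : s ∈ Icc (0 : ℝ) 1) {w w' : H2 n a b}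
    (h : HasTrace φ s w) (h' : HasTrace φ s w') : w = w' := by
  obtain ⟨S, hS, hS1, rfl⟩ := h
  obtain ⟨S', hS', hS1', rfl⟩ := h'
  exact eqOn_of_traces hS hS' hS1 hS1' hs

lemma HasTrace.sub {φ φ' : H12 n a b} {s : ℝ} {w w' : H2 n a b}
    (h : HasTrace φ s w) (h' : HasTrace φ' s w') : HasTrace (φ - φ') s (w - w') := by
  obtain ⟨S, hS, hS1, rfl⟩ := h
  obtain ⟨S', hS', hS1', rfl⟩ := h'
  refine ⟨fun r => S r - S' r, hS.sub hS', ?_, rfl⟩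
  have hsub : ∀ᵐ r ∂(volume.restrict (Icc (0 : ℝ) 1)), ∀ j : Fin 3,
      ∀ᵐ x ∂(volume.restrict (Icc a b)),
        (φ.1 0 j - φ'.1 0 j : L2 n (box a b)) (r, x) = φ.1 0 j (r, x) - φ'.1 0 j (r, x) := by
    rw [ae_all_iff]
    exact fun j => ae_slice_left (Lp.coeFn_sub (φ.1 0 j) (φ'.1 0 j))
  filter_upwards [hS1, hS1', hsub] with r h1 h2 h3 j
  have h4 : ((S r - S' r : H2 n a b)).1 j = (S r).1 j - (S' r).1 j := rfl
  rw [h4]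
  filter_upwards [h1 j, h2 j, h3 j, Lp.coeFn_sub ((S r).1 j) ((S' r).1 j)] with x h5 h6 h7 h8
  rw [h8, Pi.sub_apply, h5, h6]
  exact h7.symm

lemma XB.sub {u u' : H2 n a b} (h : u ∈ XB a b B) (h' : u' ∈ XB a b B) : u - u' ∈ XB a b B := by
  obtain ⟨f, g, hf, hg, h0, h1, hb⟩ := h
  obtain ⟨f', g', hf', hg', h0', h1', hb'⟩ := h'
  refine ⟨f - f', g - g', hf.sub hf', hg.sub hg', ?_, ?_, ?_⟩
  · exact (Lp.coeFn_sub (u.1 0) (u'.1 0)).trans (h0.sub h0')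
  · exact (Lp.coeFn_sub (u.1 1) (u'.1 1)).trans (h1.sub h1')
  · have : stack ![(f - f') a, (g - g') a, (f - f') b, (g - g') b]
        = stack ![f a, g a, f b, g b] - stack ![f' a, g' a, f' b, g' b] := by
      ext ⟨i, k⟩
      fin_cases i <;> rfl
    rw [this, mulVec_sub, hb, hb', sub_zero]

lemma dom_sub {w w' : H2 n a b × H12 n a b} (h : w ∈ dom a b B) (h' : w' ∈ dom a b B) :
    w - w' ∈ dom a b B := by
  refine ⟨XB.sub h.1 h'.1, h.2.1.sub h'.2.1, fun s hs => ?_⟩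
  obtain ⟨d, hd, hd'⟩ := h.2.2 s hs
  obtain ⟨e, he, he'⟩ := h'.2.2 s hs
  exact ⟨d - e, XB.sub hd he, hd'.sub he'⟩

lemma isWeakDeriv_one_iff {f g : L2 n (Icc a b)} : IsWeakDeriv (1 : ℝ) f g ↔
    ∀ χ : TestFunction (TopologicalSpace.Opens.interior (Icc a b)) ℝ ⊤,
      ∫ x in Icc a b, χ x • g x = -∫ x in Icc a b, deriv χ x • f x := by
  simp only [IsWeakDeriv, fderiv_apply_one_eq_deriv]

lemma integral_smul_coeFn_zero {V : Type} [MeasureSpace V] {Ω : Set V} (c : V → ℝ) :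
    ∫ x in Ω, c x • (0 : L2 n Ω) x = 0 := by
  refine integral_eq_zero_of_ae ?_
  filter_upwards [Lp.coeFn_zero (E n) 2 ((volume : Measure V).restrict Ω)] with x hx
  rw [hx]
  simp

/-- An element of `X_B` with vanishing second derivative is zero. -/
lemma XB_eq_zero (hab : a < b) (hB : IsUnit (B * Hmat n a b)) {u : H2 n a b}
    (hu : u ∈ XB a b B) (h2 : u.1 2 = 0) : u = 0 := by
  obtain ⟨f, g, hf, hg, h0, h1, hb⟩ := hu
  have w0 : IsWeakDeriv (1 : ℝ) (u.1 0) (u.1 1) := u.2 0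
  have w1 : IsWeakDeriv (1 : ℝ) (u.1 1) (u.1 2) := u.2 1
  rw [h2] at w1
  obtain ⟨d, hd⟩ := ae_eq_const_of_forall_testFunction hab (integrable_L2_Icc (u.1 1)) fun χ => by
    have := isWeakDeriv_one_iff.mp w1 χ
    rw [integral_smul_coeFn_zero] at this
    exact neg_eq_zero.mp this.symm
  have hgd : EqOn g (fun _ => d) (Icc a b) :=
    Measure.eqOn_Icc_of_ae_eq volume hab.ne (h1.symm.trans hd) hg continuousOn_const
  have hlin : Continuous fun x : ℝ => (x - a) • d := by fun_prop
  have hint : IntegrableOn (fun x => u.1 0 x - (x - a) • d) (Icc a b) :=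
    (integrable_L2_Icc (u.1 0)).sub hlin.integrableOn_Icc
  obtain ⟨c, hc⟩ := ae_eq_const_of_forall_testFunction hab hint fun χ => by
    have e1 := isWeakDeriv_one_iff.mp w0 χ
    have e2 := integral_deriv_smul_primitive hab.le (h := fun _ => d)
      (integrableOn_const (by simp)) 0 (χ := χ)
      (χ.contDiff.of_le (by simp)) (testFunction_eq_zero χ (by simp))
      (testFunction_eq_zero χ (by simp))
    simp only [intervalIntegral.integral_const, zero_add] at e2
    have e3 : ∫ x in Icc a b, χ x • u.1 1 x = ∫ x in Icc a b, χ x • d :=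
      integral_congr_ae (hd.mono fun x hx => by dsimp only; rw [hx])
    have hdχ : Continuous (deriv χ) := χ.contDiff.continuous_deriv (by simp)
    have i1 : IntegrableOn (fun x => deriv χ x • u.1 0 x) (Icc a b) :=
      (integrable_L2_Icc (u.1 0)).continuousOn_smul hdχ.continuousOn isCompact_Icc
    have i2 : IntegrableOn (fun x => deriv χ x • (x - a) • d) (Icc a b) :=
      (hdχ.smul hlin).integrableOn_Icc
    simp only [smul_sub]
    rw [integral_sub i1 i2, e2, ← e3, e1, neg_neg, sub_self]
  have hfc : EqOn f (fun x => c + (x - a) • d) (Icc a b) := by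
    refine Measure.eqOn_Icc_of_ae_eq volume hab.ne ?_ hf
      (continuousOn_const.add hlin.continuousOn)
    filter_upwards [h0, hc] with x h3 h4
    rw [← h3, ← h4, sub_add_cancel]
  have ha : a ∈ Icc a b := ⟨le_rfl, hab.le⟩
  have hb' : b ∈ Icc a b := ⟨hab.le, le_rfl⟩
  rw [hfc ha, hfc hb', hgd ha, hgd hb'] at hb
  simp only [sub_self, zero_smul, add_zero] at hb
  have hH := Hmat_mulVec_stack (a := a) (b := b) ![c, d]
  have hz : (B * Hmat n a b) *ᵥ stack ![c, d] = 0 := by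
    rw [← mulVec_mulVec, hH]
    exact hb
  have hs : stack ![c, d] = 0 := by
    have := congrArg ((B * Hmat n a b)⁻¹ *ᵥ ·) hz
    simpa [mulVec_mulVec, Matrix.nonsing_inv_mul _ ((Matrix.isUnit_iff_isUnit_det _).mp hB)]
      using this
  have hc0 : c = 0 := by
    ext k
    exact congrFun hs (0, k)
  have hd0 : d = 0 := by
    ext k
    exact congrFun hs (1, k)
  refine H2_eq_zero ?_
  rw [Lp.eq_zero_iff_ae_eq_zero]
  filter_upwards [h0, ae_restrict_mem measurableSet_Icc] with x h3 hx
  rw [h3, hfc hx]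
  simp [hc0, hd0]

/-- The product of two test functions, one in `s` and one in `x`. -/
def tensorTest (χ : TestFunction (TopologicalSpace.Opens.interior (Icc (0 : ℝ) 1)) ℝ ⊤)
    (η : TestFunction (TopologicalSpace.Opens.interior (Icc a b)) ℝ ⊤) :
    TestFunction (TopologicalSpace.Opens.interior (box a b)) ℝ ⊤ :=
  have hs : tsupport (fun p : ℝ × ℝ => χ p.1 * η p.2) ⊆ tsupport χ ×ˢ tsupport η := by
    refine closure_minimal (fun p hp => ?_) ((isClosed_tsupport _).prod (isClosed_tsupport _))
    exact ⟨subset_tsupport _ (left_ne_zero_of_mul hp), subset_tsupport _ (right_ne_zero_of_mul hp)⟩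
  { toFun := fun p => χ p.1 * η p.2
    contDiff' := (χ.contDiff.comp contDiff_fst).mul (η.contDiff.comp contDiff_snd)
    hasCompactSupport' := (χ.hasCompactSupport.isCompact.prod
      η.hasCompactSupport.isCompact).of_isClosed_subset (isClosed_tsupport _) hs
    tsupport_subset' := hs.trans (by
      change _ ⊆ interior (box a b)
      rw [box, interior_prod_eq]
      exact Set.prod_mono χ.tsupport_subset η.tsupport_subset) }

lemma fderiv_tensorTest (χ : TestFunction (TopologicalSpace.Opens.interior (Icc (0 : ℝ) 1)) ℝ ⊤)
    (η : TestFunction (TopologicalSpace.Opens.interior (Icc a b)) ℝ ⊤) (p : ℝ × ℝ) :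
    fderiv ℝ (tensorTest χ η) p ((1 : ℝ), (0 : ℝ)) = deriv χ p.1 * η p.2 := by
  have hd : Differentiable ℝ (tensorTest χ η) := (tensorTest χ η).contDiff.differentiable (by simp)
  have h1 := (hd p).hasFDerivAt.comp_hasDerivAt p.1
    ((hasDerivAt_id p.1).prodMk (hasDerivAt_const p.1 p.2))
  have h2 : HasDerivAt (fun s => χ s * η p.2) (deriv χ p.1 * η p.2) p.1 :=
    ((χ.contDiff.differentiable (by simp)) p.1).hasDerivAt.mul_const _
  exact h1.unique h2

/-- The pairing of an `L₂` function with a test function is continuous. -/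
lemma exists_pairing_clm (η : TestFunction (TopologicalSpace.Opens.interior (Icc a b)) ℝ ⊤) :
    ∃ Λ : L2 n (Icc a b) →L[ℝ] E n, ∀ v, Λ v = ∫ x in Icc a b, η x • v x := by
  have hη : MemLp η 2 (volume.restrict (Icc a b)) :=
    η.contDiff.continuous.memLp_of_hasCompactSupport η.hasCompactSupport
  refine ⟨(ContinuousLinearMap.lsmul ℝ ℝ : ℝ →L[ℝ] E n →L[ℝ] E n).lpPairing
    (volume.restrict (Icc a b)) 2 2 hη.toLp, fun v => ?_⟩
  rw [ContinuousLinearMap.lpPairing_eq_integral]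
  refine integral_congr_ae ?_
  filter_upwards [hη.coeFn_toLp] with x hx
  rw [hx]
  rfl

/-- If `∂ₛ∂ₓ²φ = 0`, then the second derivative of the trace of `φ` does not depend on `s`. -/
lemma trace_second_deriv_const {φ : H12 n a b} (h : φ.1 1 2 = 0) {S : ℝ → H2 n a b}
    (hS : ContinuousOn S (Icc 0 1))
    (hφ : ∀ᵐ r ∂(volume.restrict (Icc (0 : ℝ) 1)), ∀ j : Fin 3,
      (S r).1 j =ᵐ[volume.restrict (Icc a b)] fun x => φ.1 0 j (r, x))
    {s : ℝ} (hs : s ∈ Icc (0 : ℝ) 1) : (S s).1 2 = (S 0).1 2 := by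
  have hw : IsWeakDeriv ((1 : ℝ), (0 : ℝ)) (φ.1 0 2) (φ.1 1 2) := φ.2.1 0 2
  rw [h] at hw
  rw [← sub_eq_zero, Lp.eq_zero_iff_ae_eq_zero]
  refine ae_eq_zero_of_forall_testFunction volume_frontier_Icc (integrable_L2_Icc _) fun η => ?_
  obtain ⟨Λ, hΛ⟩ := exists_pairing_clm (n := n) η
  rw [← hΛ, map_sub, sub_eq_zero]
  have hcont : ContinuousOn (fun r => Λ ((S r).1 2)) (Icc 0 1) := by
    have h1 : Continuous fun u : H2 n a b => Λ (u.1 2) :=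
      Λ.continuous.comp ((continuous_apply 2).comp continuous_subtype_val)
    exact h1.comp_continuousOn hS
  obtain ⟨c, hc⟩ := ae_eq_const_of_forall_testFunction zero_lt_one hcont.integrableOn_Icc fun χ => by
    have e1 := hw (tensorTest χ η)
    have i1 := integrable_test_smul (φ.1 0 2)
      (continuous_fderiv_test (tensorTest χ η) ((1 : ℝ), (0 : ℝ)))
      (hasCompactSupport_fderiv_test (tensorTest χ η) _)
    rw [integral_smul_coeFn_zero, integral_box i1] at e1
    rw [← neg_eq_zero, e1, neg_inj]
    refine integral_congr_ae ?_
    filter_upwards [hφ] with r hr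
    rw [hΛ, ← integral_smul]
    refine integral_congr_ae ?_
    filter_upwards [hr 2] with x hx
    rw [hx, fderiv_tensorTest, mul_smul]
  have := Measure.eqOn_Icc_of_ae_eq volume zero_ne_one hc hcont continuousOn_const
  exact (this hs).trans (this ⟨le_rfl, zero_le_one⟩).symm

lemma dom_eq_zero (hab : a < b) (hB : IsUnit (B * Hmat n a b)) {w : H2 n a b × H12 n a b}
    (hw : w ∈ dom a b B) (h : fund w = 0) : w = 0 := by
  have h1 : w.1 = 0 := XB_eq_zero hab hB hw.1 (congrArg Prod.fst h)
  refine Prod.ext h1 (H12_eq_zero ?_)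
  obtain ⟨⟨S, hS, hφ, hS0⟩, hX⟩ := hw.2
  have hS0' : (S 0).1 2 = 0 := by rw [hS0, h1]; rfl
  have hSz : ∀ s ∈ Icc (0 : ℝ) 1, S s = 0 := by
    intro s hs
    obtain ⟨d, hd, hd'⟩ := hX s hs
    have : S s = d := HasTrace.unique hs ⟨S, hS, hφ, rfl⟩ hd'
    refine XB_eq_zero hab hB (this ▸ hd) ?_
    rw [trace_second_deriv_const (congrArg Prod.snd h) hS hφ hs, hS0']
  have hm : MeasurableSet {p : ℝ × ℝ | w.2.1 0 0 p = 0} :=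
    (Lp.stronglyMeasurable (w.2.1 0 0)).measurableSet_eq_fun stronglyMeasurable_const
  have hae : ∀ᵐ p ∂((volume.restrict (Icc (0 : ℝ) 1)).prod (volume.restrict (Icc a b))),
      w.2.1 0 0 p = 0 := by
    rw [Measure.ae_prod_iff_ae_ae hm]
    filter_upwards [hφ, ae_restrict_mem measurableSet_Icc] with r hr hr'
    have h0 : (S r).1 0 = 0 := by rw [hSz r hr']; rfl
    filter_upwards [hr 0, (Lp.eq_zero_iff_ae_eq_zero).mp h0] with x h3 h4
    rw [← h3, h4]
    rfl
  rw [← volume_restrict_box] at hae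
  exact (Lp.eq_zero_iff_ae_eq_zero).mpr hae

lemma solve_fund (hab : a < b) (hB : IsUnit (B * Hmat n a b)) {w : H2 n a b × H12 n a b}
    (hw : w ∈ dom a b B) : solve B hab.le (fund w) = w := by
  have := dom_eq_zero hab hB (dom_sub (solve_mem_dom hB hab.le (fund w)) hw)
    (sub_eq_zero.mpr (fund_solve hab.le (fund w)))
  exact sub_eq_zero.mp this

end Uniqueness

/-! ### The equations -/

section Equations

variable {n : ℕ} {a b : ℝ} {B : Matrix (Fin 2 × Fin n) (Fin 4 × Fin n) ℝ}

lemma opA11_ae (A : ℝ → Matrix (Fin n) (Fin 3 × Fin n) ℝ) (v : L2 n (Icc a b)) :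
    opA11 a b B A v =ᵐ[volume.restrict (Icc a b)]
      fun x => mulE (A x) (stack fun j => opG a b B j v x) := by
  filter_upwards [opG_zero_ae (B := B) v, opG_one_ae (B := B) v, ae_restrict_mem measurableSet_Icc]
    with x h0 h1 hx
  rw [opA11_eq (integrable_L2_Icc v) hx, ← h0, ← h1]
  congr 2
  ext1 j
  fin_cases j <;> rfl

lemma opA12_ae (A : ℝ → Matrix (Fin n) (Fin 3 × Fin n) ℝ) (ψ : L2 n (box a b)) :
    opA12 a b B A ψ =ᵐ[volume.restrict (Icc a b)]
      fun x => mulE (A x) (stack fun j => opG a b B j (avgCLM n a b 1 ψ) x) := by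
  have h1 : (1 : ℝ) ∈ Icc (0 : ℝ) 1 := ⟨zero_le_one, le_rfl⟩
  filter_upwards [opG_zero_ae (B := B) (avgCLM n a b 1 ψ), opG_one_ae (B := B) (avgCLM n a b 1 ψ),
    avgCLM_ae h1 ψ, (integrable_L2_box ψ).prod_left_ae, ae_restrict_mem measurableSet_Icc]
    with x e0 e1 e2 hi hx
  set w : ℝ → Fin 3 → E n := fun s => ![intOp a b (ker0 a b B) (fun y => ψ (s, y)) x,
    intOp a b (ker1 a b B) (fun y => ψ (s, y)) x, ψ (s, x)] with hw
  have hwi : ∀ j, IntegrableOn (fun s => w s j) (Icc 0 1) := by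
    intro j
    fin_cases j
    · exact (integrable_intOp_slices isBddKer_ker0 ψ hx).integral_prod_left
    · exact (integrable_intOp_slices isBddKer_ker1 ψ hx).integral_prod_left
    · exact hi
  have hop : ∀ᵐ s ∂(volume.restrict (Icc (0 : ℝ) 1)),
      opA11 a b B A (fun y => ψ (s, y)) x = mulE (A x) (stack (w s)) := by
    filter_upwards [(integrable_L2_box ψ).prod_right_ae] with s hs
    exact opA11_eq hs hx A
  have hI : ∀ f : ℝ → E n, ∫ s in (0 : ℝ)..1, f s = ∫ s in Icc (0 : ℝ) 1, f s := fun f => by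
    rw [intervalIntegral.integral_of_le zero_le_one, integral_Icc_eq_integral_Ioc]
  rw [opA12, intervalIntegral_congr_ae_Icc h1 hop, hI, integral_mulE_stack _ hwi]
  congr 2
  ext1 j
  fin_cases j
  · refine (hI _).symm.trans (Eq.trans ?_ e0.symm)
    rw [intOp_congr_ae (avgCLM_ae h1 ψ), intOp_integral_slices isBddKer_ker0 ψ hx h1]
    rfl
  · refine (hI _).symm.trans (Eq.trans ?_ e1.symm)
    rw [intOp_congr_ae (avgCLM_ae h1 ψ), intOp_integral_slices isBddKer_ker1 ψ hx h1]
    rfl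
  · exact (hI _).symm.trans e2.symm

lemma opA_fst_ae (τ : ℝ) (A Ad : ℝ → Matrix (Fin n) (Fin 3 × Fin n) ℝ) (hab : a ≤ b)
    (z : Z n a b) : (opA a b B τ A Ad z.toFun).1 =ᵐ[volume.restrict (Icc a b)] fun x =>
      mulE (A x) (stack fun j : Fin 3 => (solve B hab z).1.1 j x) +
        mulE (Ad x) (stack fun j : Fin 3 => (solveH2 B hab (z.1 + avgCLM n a b 1 z.2)).1 j x) := by
  have hadd : ∀ᵐ x ∂(volume.restrict (Icc a b)), ∀ j : Fin 3,
      opG a b B j (z.1 + avgCLM n a b 1 z.2) x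
        = opG a b B j z.1 x + opG a b B j (avgCLM n a b 1 z.2) x := by
    rw [ae_all_iff]
    intro j
    rw [map_add]
    exact Lp.coeFn_add _ _
  filter_upwards [opA11_ae (B := B) A z.1, opA11_ae (B := B) Ad z.1, opA12_ae (B := B) Ad z.2, hadd]
    with x h1 h2 h3 h4
  change opA11 a b B A z.1 x + opA11 a b B Ad z.1 x + opA12 a b B Ad z.2 x = _
  rw [h1, h2, h3, add_assoc, ← mulE_stack_add]
  congr 3
  ext1 j
  exact (h4 j).symm

/-- The equations of the delayed PDE for `𝒯z`, with time derivative `𝒯y`, hold if and only if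
`𝒯y = 𝒜z`. -/
lemma solve_equations_iff (hab : a ≤ b) (τ : ℝ) (A Ad : ℝ → Matrix (Fin n) (Fin 3 × Fin n) ℝ)
    (z y : Z n a b) :
    ((∃ d : H2 n a b, HasTrace (solve B hab z).2 1 d ∧
        (solve B hab y).1.1 0 =ᵐ[volume.restrict (Icc a b)] fun x =>
          mulE (A x) (stack fun j : Fin 3 => (solve B hab z).1.1 j x) +
            mulE (Ad x) (stack fun j : Fin 3 => d.1 j x)) ∧
      (solve B hab y).2.1 0 0 = -(1 / τ) • (solve B hab z).2.1 1 0) ↔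
    EqAE a b (opT a b B y.toFun) (opA a b B τ A Ad z.toFun) := by
  have hT := sobFun_solve (B := B) hab y
  have h22 : (-(1 / τ) • (solve B hab z).2.1 1 0 : L2 n (box a b)) =ᵐ[volume.restrict (box a b)]
      (opA a b B τ A Ad z.toFun).2 := by
    filter_upwards [Lp.coeFn_smul (-(1 / τ)) ((solve B hab z).2.1 1 0),
      opGbox_zero_ae_opT1 (B := B) z.2] with p h1 h2
    rw [h1, Pi.smul_apply]
    exact congrArg (-(1 / τ) • ·) h2
  have hA := opA_fst_ae (B := B) τ A Ad hab z
  constructor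
  · rintro ⟨⟨d, hd, h1⟩, h2⟩
    have hd' := HasTrace.unique ⟨zero_le_one, le_rfl⟩ hd (hasTrace_solveH12 hab z 1)
    subst hd'
    refine ⟨hT.1.symm.trans (h1.trans hA.symm), hT.2.symm.trans (EventuallyEq.trans ?_ h22)⟩
    rw [← h2]
    rfl
  · rintro ⟨h1, h2⟩
    refine ⟨⟨_, hasTrace_solveH12 hab z 1, hT.1.trans (h1.trans hA)⟩, Lp.ext ?_⟩
    exact hT.2.trans (h2.trans h22.symm)

/-- `fund` as a bounded operator. -/
def fundCLM (n : ℕ) (a b : ℝ) : H2 n a b × H12 n a b →L[ℝ] Z n a b :=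
  (((ContinuousLinearMap.proj 2).comp (Sob1 n 2 a b).subtypeL).comp
      (ContinuousLinearMap.fst ℝ _ _)).prod
    ((((ContinuousLinearMap.proj 2).comp (ContinuousLinearMap.proj 1)).comp
      (Sob2 n 1 2 a b).subtypeL).comp (ContinuousLinearMap.snd ℝ _ _))

lemma fundCLM_apply (w : H2 n a b × H12 n a b) : fundCLM n a b w = fund w := rfl

/-- The delayed PDE is equivalent to the PIE along curves `w = 𝒯z`. -/
lemma isDPDESolution_iff_isPIESolution (hab : a < b) (hB : IsUnit (B * Hmat n a b)) (τ : ℝ)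
    (A Ad : ℝ → Matrix (Fin n) (Fin 3 × Fin n) ℝ) {z₀ : Z n a b} {z : ℝ → Z n a b}
    {w : ℝ → H2 n a b × H12 n a b} (hw : ∀ t, 0 ≤ t → w t = solve B hab.le (z t)) :
    IsDPDESolution τ A Ad B (solve B hab.le z₀) w ↔
      IsPIESolution (opT a b B) (opA a b B τ A Ad) z₀ z := by
  have hz : ∀ t, 0 ≤ t → z t = fundCLM n a b (w t) := fun t ht => by
    rw [hw t ht, fundCLM_apply, fund_solve]
  have hdiff : DifferentiableOn ℝ w (Ici 0) ↔ DifferentiableOn ℝ z (Ici 0) := by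
    constructor
    · intro h
      exact ((fundCLM n a b).differentiable.comp_differentiableOn h).congr fun t ht => hz t ht
    · intro h
      exact ((solve B hab.le).differentiable.comp_differentiableOn h).congr fun t ht => hw t ht
  have hderiv : DifferentiableOn ℝ z (Ici 0) → ∀ t, 0 ≤ t →
      derivWithin w (Ici 0) t = solve B hab.le (derivWithin z (Ici 0) t) := by
    intro h t ht
    have h1 := (solve B hab.le).hasFDerivAt.comp_hasDerivWithinAt t (h t ht).hasDerivWithinAt
    exact (h1.congr_of_mem (fun s hs => hw s hs) ht).derivWithin (uniqueDiffOn_Ici 0 t ht)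
  have h0 : w 0 = solve B hab.le z₀ ↔ z 0 = z₀ := by
    constructor
    · intro h
      rw [hz 0 le_rfl, h, fundCLM_apply, fund_solve]
    · intro h
      rw [hw 0 le_rfl, h]
  unfold IsDPDESolution IsPIESolution
  rw [hdiff, h0]
  constructor
  · rintro ⟨-, hd, hi, h⟩
    refine ⟨hd, hi, fun t ht => ?_⟩
    have ht' := (h t ht).2
    rw [hderiv hd t ht, hw t ht] at ht'
    exact (solve_equations_iff hab.le τ A Ad _ _).mp ht'
  · rintro ⟨hd, hi, h⟩
    refine ⟨solve_mem_dom hB hab.le z₀, hd, hi, fun t ht => ?_⟩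
    have ht' := (solve_equations_iff hab.le τ A Ad _ _).mpr (h t ht)
    rw [hderiv hd t ht, hw t ht]
    exact ⟨solve_mem_dom hB hab.le (z t), ht'⟩

lemma eq_solve_of_sobFun_ae (hab : a ≤ b) {w : H2 n a b × H12 n a b} {z : Z n a b}
    (h : EqAE a b (sobFun w) (opT a b B z.toFun)) : w = solve B hab z :=
  have hs := sobFun_solve (B := B) hab z
  eq_of_sobFun_ae ⟨h.1.trans hs.1.symm, h.2.trans hs.2.symm⟩

end Equations

end DPDE

end

theorem mainTheorem2 (n : ℕ) (a b τ : ℝ) (hab : a < b) (hτ : 0 < τ)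
    (A Ad : ℝ → Matrix (Fin n) (Fin 3 × Fin n) ℝ)
    (hA : DPDE.MemLinfty a b A) (hAd : DPDE.MemLinfty a b Ad)
    (B : Matrix (Fin 2 × Fin n) (Fin 4 × Fin n) ℝ)
    (hB : IsUnit (B * DPDE.Hmat n a b)) :
    (∀ (z₀ : DPDE.Z n a b) (z : ℝ → DPDE.Z n a b),
      DPDE.IsPIESolution (DPDE.opT a b B) (DPDE.opA a b B τ A Ad) z₀ z ↔
        ∃ (w₀ : DPDE.H2 n a b × DPDE.H12 n a b) (w : ℝ → DPDE.H2 n a b × DPDE.H12 n a b),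
          DPDE.EqAE a b (DPDE.sobFun w₀) (DPDE.opT a b B z₀.toFun) ∧
          (∀ t, 0 ≤ t → DPDE.EqAE a b (DPDE.sobFun (w t)) (DPDE.opT a b B (z t).toFun)) ∧
          DPDE.IsDPDESolution τ A Ad B w₀ w) ∧
    (∀ (w₀ : DPDE.H2 n a b × DPDE.H12 n a b) (w : ℝ → DPDE.H2 n a b × DPDE.H12 n a b),
      w₀ ∈ DPDE.dom a b B → (∀ t, 0 ≤ t → w t ∈ DPDE.dom a b B) →
      (DPDE.IsDPDESolution τ A Ad B w₀ w ↔
        DPDE.IsPIESolution (DPDE.opT a b B) (DPDE.opA a b B τ A Ad)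
          (DPDE.fund w₀) (fun t => DPDE.fund (w t)))) := by
  constructor
  · intro z₀ z
    constructor
    · intro h
      exact ⟨DPDE.solve B hab.le z₀, fun t => DPDE.solve B hab.le (z t),
        DPDE.sobFun_solve hab.le z₀, fun t _ => DPDE.sobFun_solve hab.le (z t),
        (DPDE.isDPDESolution_iff_isPIESolution hab hB τ A Ad fun _ _ => rfl).mpr h⟩
    · rintro ⟨w₀, w, h0, hw, h⟩
      rw [DPDE.eq_solve_of_sobFun_ae hab.le h0] at h
      exact (DPDE.isDPDESolution_iff_isPIESolution hab hB τ A Ad fun t ht =>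
        DPDE.eq_solve_of_sobFun_ae hab.le (hw t ht)).mp h
  · intro w₀ w h0 hw
    have h := DPDE.isDPDESolution_iff_isPIESolution hab hB τ A Ad (z₀ := DPDE.fund w₀)
      (z := fun t => DPDE.fund (w t)) (w := w) fun t ht => (DPDE.solve_fund hab hB (hw t ht)).symm
    rwa [DPDE.solve_fund hab hB h0] at h
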